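/- Let $D$ be a metric space that is uniformly discrete ($\inf_{x\ne y}d(x,y)>0$) and has bounded geometry (for every $R>0$ the number of points in balls of radius $R$ is uniformly bounded). For a Hilbert space $H$, let $C^*_H(D)$ be the norm closure of the $*$-algebra of all bounded operators $T$ on $\ell^2(D)\otimes H$ that are locally compact ($Tf$ and $fT$ are compact for every $f\in C_0(D)$ acting by multiplication) and of finite propagation (there is $R>0$ with $fTg=0$ whenever $f,g\in C_0(D)$ have supports at distance greater than $R$). Thus $C^*_{\mathbb C}(D)$ is the uniform Roe algebra, which is unital, and for infinite-dimensional $H$ the algebra $C^*_H(D)$ is the Roe algebra of $D$. Fix an infinite-dimensional $H$ and an isometry $V:\mathbb C\to H$, put $V_D=\mathrm{id}\otimes V:\ell^2(D)\to \ell^2(D)\otimes H$, and let $i_D:C^*_{\mathbb C}(D)\to C^*_H(D)$ be the $*$-homomorphism $i_D(T)=V_DTV_D^*$. For $\alpha>0$ let $D(\alpha)$ be the graph with vertex set $D$ in which two distinct points $x,y$ are joined by an edge whenever $d(x,y)\le\alpha$. For a locally finite graph $\Gamma$ with vertex set $\Gamma_0$ and edge set $\Gamma_1$, let $C_k^{BM}(\Gamma)$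 ($k=0,1$) be the group of all (possibly infinite) formal sums $\sum_{x\in\Gamma_k}\lambda_x x$, $\lambda_x\in\mathbb Z$, and let $H_0^{BM}(\Gamma)=C_0^{BM}(\Gamma)/\partial C_1^{BM}(\Gamma)$, where $\partial$ is the usual boundary map (end minus start of an edge, for a chosen orientation of the edges). For $\alpha\le\beta$ the inclusion $D(\alpha)\subset D(\beta)$ induces a map $H_0^{BM}(D(\alpha))\to H_0^{BM}(D(\beta))$. Let $c=\sum_{x\in D}x$ be the $0$-chain with all coefficients equal to $1$; its classes in the groups $H_0^{BM}(D(\alpha))$ are compatible with these maps and define a class $[c]$ in the direct limit. The following are equivalent: 1. $(i_D)_*([1])=0$ in $K_0(C^*_H(D))$; 2. $[c]=0$ in $\varinjlim_{\alpha}H_0^{BM}(D(\alpha))$. -/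

import Mathlib

open scoped ZeroAtInfty ENNReal

noncomputable section

namespace CoarseK

/-! ## Roe algebras -/

section Roe

variable {X : Type*} [MetricSpace X]
  {E : Type*} [NormedAddCommGroup E] [InnerProductSpace ℂ E] [CompleteSpace E]

/-- The distance `inf {d(x, y) : x ∈ s, y ∈ t}` between two sets (it is `∞` if one is empty). -/
def setDist (s t : Set X) : ℝ≥0∞ := ⨅ x ∈ s, ⨅ y ∈ t, edist x y

/-- `T` is locally compact: `T ψ(f)` and `ψ(f) T` are compact for all `f ∈ C₀(X)`. -/
def IsLocallyCompactOp (ψ : C₀(X, ℂ) →⋆ₙₐ[ℂ] (E →L[ℂ] E)) (T : E →L[ℂ] E) : Prop :=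
  ∀ f : C₀(X, ℂ), IsCompactOperator (T * ψ f) ∧ IsCompactOperator (ψ f * T)

/-- `T` has finite propagation: for some `R > 0`, `ψ(f) T ψ(g) = 0` whenever the distance between
the supports of `f, g ∈ C₀(X)` is greater than `R`. -/
def HasFinitePropagation (ψ : C₀(X, ℂ) →⋆ₙₐ[ℂ] (E →L[ℂ] E)) (T : E →L[ℂ] E) : Prop :=
  ∃ R : ℝ, 0 < R ∧ ∀ f g : C₀(X, ℂ),
    ENNReal.ofReal R < setDist (tsupport f) (tsupport g) → ψ f * T * ψ g = 0

/-- The action of `C₀(X)` is nondegenerate: `{ψ(f) ξ}` is dense. -/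
def IsNondegenerate (ψ : C₀(X, ℂ) →⋆ₙₐ[ℂ] (E →L[ℂ] E)) : Prop :=
  Dense {v : E | ∃ (f : C₀(X, ℂ)) (ξ : E), ψ f ξ = v}

lemma isCompactOperator_adjoint {T : E →L[ℂ] E} (hT : IsCompactOperator T) :
    IsCompactOperator (star T : E →L[ℂ] E) := by
  have hS : IsCompactOperator (T * star T) := hT.comp_clm _
  refine (isCompactOperator_iff_isCompact_closure_image_ball (𝕜₁ := ℂ)
    (star T).toLinearMap one_pos).2 ?_
  have h1 := hS.isCompact_closure_image_ball (𝕜₁ := ℂ) (f := (T * star T).toLinearMap) 1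
  refine TotallyBounded.isCompact_of_isClosed (TotallyBounded.closure ?_) isClosed_closure
  have h2 := h1.totallyBounded.subset subset_closure
  refine Metric.totallyBounded_iff.2 fun ε hε => ?_
  obtain ⟨t, hts, htf, htc⟩ :=
    Metric.finite_approx_of_totallyBounded h2 (ε ^ 2 / 2) (by positivity)
  have hts' : ∀ y ∈ t, ∃ v ∈ Metric.ball (0 : E) 1, (T * star T) v = y := fun y hy => hts hy
  choose! u hu using hts'
  refine ⟨(fun y => star T (u y)) '' t, htf.image _, ?_⟩
  rintro _ ⟨v, hv, rfl⟩
  obtain ⟨y, hy, hvy⟩ := Set.mem_iUnion₂.1 (htc ⟨v, hv, rfl⟩)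
  simp only [Set.biUnion_image, Set.mem_iUnion₂, Metric.mem_ball]
  refine ⟨y, hy, ?_⟩
  obtain ⟨hu1, hu2⟩ := hu y hy
  rw [Metric.mem_ball, ← hu2] at hvy
  simp only [ContinuousLinearMap.coe_coe, dist_eq_norm] at hvy ⊢
  rw [← map_sub] at hvy ⊢
  set w := v - u y with hw
  have hwn : ‖w‖ ≤ 2 := by
    refine (norm_sub_le _ _).trans ?_
    have := mem_ball_zero_iff.1 hv
    have := mem_ball_zero_iff.1 hu1
    linarith
  have key : ‖star T w‖ ^ 2 ≤ ‖(T * star T) w‖ * ‖w‖ := by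
    have h := norm_inner_le_norm (𝕜 := ℂ) ((T * star T) w) w
    have h' : inner ℂ ((T * star T) w) w = inner ℂ (star T w) (star T w) := by
      rw [ContinuousLinearMap.star_eq_adjoint, ContinuousLinearMap.adjoint_inner_right]
      rfl
    rw [h', inner_self_eq_norm_sq_to_K] at h
    simpa using h
  have : ‖star T w‖ ^ 2 < ε ^ 2 := by
    have h0 := norm_nonneg ((T * star T) w)
    nlinarith
  exact lt_of_pow_lt_pow_left₀ 2 hε.le this

lemma norm_rep_le (ψ : C₀(X, ℂ) →⋆ₙₐ[ℂ] (E →L[ℂ] E)) (f : C₀(X, ℂ)) : ‖ψ f‖ ≤ ‖f‖ :=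
  NonUnitalStarAlgHom.norm_apply_le ψ f

lemma ofReal_lt_setDist {s t : Set X} {R S : ℝ} (hRS : R < S) (hS : 0 < S)
    (h : ∀ x ∈ s, ∀ y ∈ t, S ≤ dist x y) : ENNReal.ofReal R < setDist s t := by
  refine lt_of_lt_of_le ((ENNReal.ofReal_lt_ofReal_iff hS).2 hRS) ?_
  refine le_iInf₂ fun x hx => le_iInf₂ fun y hy => ?_
  rw [edist_dist]
  exact ENNReal.ofReal_le_ofReal (h x hx y hy)

lemma lt_dist_of_ofReal_lt_setDist {s t : Set X} {R : ℝ}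
    (h : ENNReal.ofReal R < setDist s t) {x y : X} (hx : x ∈ s) (hy : y ∈ t) : R < dist x y := by
  have : ENNReal.ofReal R < edist x y := h.trans_le ((iInf₂_le x hx).trans (iInf₂_le y hy))
  rw [edist_dist] at this
  exact lt_of_not_ge fun h' => absurd (ENNReal.ofReal_le_ofReal h') (not_le.2 this)

lemma setDist_comm (s t : Set X) : setDist s t = setDist t s := by
  unfold setDist
  rw [iInf₂_comm]
  simp_rw [edist_comm]

lemma IsLocallyCompactOp.add {ψ : C₀(X, ℂ) →⋆ₙₐ[ℂ] (E →L[ℂ] E)} {S T : E →L[ℂ] E}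
    (hS : IsLocallyCompactOp ψ S) (hT : IsLocallyCompactOp ψ T) :
    IsLocallyCompactOp ψ (S + T) := fun f => by
  rw [add_mul, mul_add]
  exact ⟨(hS f).1.add (hT f).1, (hS f).2.add (hT f).2⟩

lemma IsLocallyCompactOp.smul {ψ : C₀(X, ℂ) →⋆ₙₐ[ℂ] (E →L[ℂ] E)} {T : E →L[ℂ] E}
    (hT : IsLocallyCompactOp ψ T) (c : ℂ) : IsLocallyCompactOp ψ (c • T) := fun f => by
  rw [smul_mul_assoc, mul_smul_comm]
  exact ⟨(hT f).1.smul c, (hT f).2.smul c⟩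

lemma IsLocallyCompactOp.mul {ψ : C₀(X, ℂ) →⋆ₙₐ[ℂ] (E →L[ℂ] E)} {S T : E →L[ℂ] E}
    (hS : IsLocallyCompactOp ψ S) (hT : IsLocallyCompactOp ψ T) :
    IsLocallyCompactOp ψ (S * T) := fun f => by
  rw [mul_assoc, ← mul_assoc (ψ f)]
  exact ⟨(hT f).1.clm_comp S, (hS f).2.comp_clm T⟩

lemma IsLocallyCompactOp.star {ψ : C₀(X, ℂ) →⋆ₙₐ[ℂ] (E →L[ℂ] E)} {T : E →L[ℂ] E}
    (hT : IsLocallyCompactOp ψ T) : IsLocallyCompactOp ψ (star T) := fun f => by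
  have h := hT (Star.star f)
  constructor
  · simpa [map_star] using isCompactOperator_adjoint h.2
  · simpa [map_star] using isCompactOperator_adjoint h.1

lemma HasFinitePropagation.add {ψ : C₀(X, ℂ) →⋆ₙₐ[ℂ] (E →L[ℂ] E)} {S T : E →L[ℂ] E}
    (hS : HasFinitePropagation ψ S) (hT : HasFinitePropagation ψ T) :
    HasFinitePropagation ψ (S + T) := by
  obtain ⟨R, hR, h⟩ := hS
  obtain ⟨R', hR', h'⟩ := hT
  refine ⟨max R R', lt_max_of_lt_left hR, fun f g hfg => ?_⟩
  rw [mul_add, add_mul, h f g, h' f g, add_zero]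
  · exact (ENNReal.ofReal_le_ofReal (le_max_right _ _)).trans_lt hfg
  · exact (ENNReal.ofReal_le_ofReal (le_max_left _ _)).trans_lt hfg

lemma HasFinitePropagation.smul {ψ : C₀(X, ℂ) →⋆ₙₐ[ℂ] (E →L[ℂ] E)} {T : E →L[ℂ] E}
    (hT : HasFinitePropagation ψ T) (c : ℂ) : HasFinitePropagation ψ (c • T) := by
  obtain ⟨R, hR, h⟩ := hT
  refine ⟨R, hR, fun f g hfg => ?_⟩
  rw [mul_smul_comm, smul_mul_assoc, h f g hfg, smul_zero]

lemma HasFinitePropagation.star {ψ : C₀(X, ℂ) →⋆ₙₐ[ℂ] (E →L[ℂ] E)} {T : E →L[ℂ] E}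
    (hT : HasFinitePropagation ψ T) : HasFinitePropagation ψ (star T) := by
  obtain ⟨R, hR, h⟩ := hT
  refine ⟨R, hR, fun f g hfg => ?_⟩
  have hs : ∀ k : C₀(X, ℂ), tsupport (Star.star k : C₀(X, ℂ)) = tsupport k := fun k => by
    unfold tsupport Function.support
    simp
  have := h (Star.star g) (Star.star f) (by rw [hs, hs, setDist_comm]; exact hfg)
  simpa [map_star, mul_assoc] using congrArg Star.star this

/-- Multiplication of `h ∈ C₀(X)` by a bounded continuous function. -/
def bddMul (φ : C(X, ℝ)) (hφ : ∀ x, |φ x| ≤ 1) (h : C₀(X, ℂ)) : C₀(X, ℂ) where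
  toFun x := (φ x : ℂ) * h x
  continuous_toFun := by fun_prop
  zero_at_infty' := by
    refine squeeze_zero_norm (fun x => ?_) (by simpa using h.zero_at_infty'.norm)
    rw [norm_mul, Complex.norm_real]
    exact mul_le_of_le_one_left (norm_nonneg _) (hφ x)

/-- A nondegenerate action has enough local units. -/
lemma IsNondegenerate.apply_eq_zero {ψ : C₀(X, ℂ) →⋆ₙₐ[ℂ] (E →L[ℂ] E)} (hψ : IsNondegenerate ψ)
    (A : E →L[ℂ] E) (u : E) (h : ∀ e : C₀(X, ℂ), A (ψ e u) = 0) : A u = 0 := by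
  rw [← norm_le_zero_iff]
  refine le_of_forall_pos_le_add fun ε hε => ?_
  obtain ⟨δ, hδ, hδε⟩ : ∃ δ : ℝ, 0 < δ ∧ ‖A‖ * (3 * δ) ≤ ε := by
    refine ⟨ε / (3 * (‖A‖ + 1)), by positivity, ?_⟩
    rw [mul_div_assoc', mul_div_assoc', div_le_iff₀ (by positivity)]
    nlinarith [norm_nonneg A]
  obtain ⟨_, hk, ⟨k, ξ, rfl⟩⟩ := Metric.dense_iff.1 hψ u δ hδ
  rw [Metric.mem_ball, dist_eq_norm, norm_sub_rev] at hk
  set η : ℝ := δ / (‖ξ‖ + 1) with hη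
  have hη0 : 0 < η := by positivity
  let e : C₀(X, ℂ) :=
    { toFun := fun x => ((‖k x‖ / (‖k x‖ + η) : ℝ) : ℂ)
      continuous_toFun := by
        refine Complex.continuous_ofReal.comp (Continuous.div (by fun_prop) (by fun_prop) ?_)
        intro x; positivity
      zero_at_infty' := by
        refine squeeze_zero_norm (a := fun x => ‖k x‖ / η) (fun x => ?_) ?_
        · rw [Complex.norm_real, Real.norm_of_nonneg (by positivity)]
          gcongr
          linarith [norm_nonneg (k x)]
        · simpa using (k.zero_at_infty'.norm).div_const η }
  have he1 : ‖e‖ ≤ 1 := by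
    rw [← ZeroAtInftyContinuousMap.norm_toBCF_eq_norm,
      BoundedContinuousFunction.norm_le zero_le_one]
    intro x
    change ‖((‖k x‖ / (‖k x‖ + η) : ℝ) : ℂ)‖ ≤ 1
    rw [Complex.norm_real, Real.norm_of_nonneg (by positivity)]
    exact div_le_one_of_le₀ (by linarith) (by positivity)
  have he2 : ‖k - e * k‖ ≤ η := by
    rw [← ZeroAtInftyContinuousMap.norm_toBCF_eq_norm,
      BoundedContinuousFunction.norm_le hη0.le]
    intro x
    change ‖k x - ((‖k x‖ / (‖k x‖ + η) : ℝ) : ℂ) * k x‖ ≤ η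
    have hpos : 0 < ‖k x‖ + η := by positivity
    have h1 : k x - ((‖k x‖ / (‖k x‖ + η) : ℝ) : ℂ) * k x
        = ((η / (‖k x‖ + η) : ℝ) : ℂ) * k x := by
      rw [← one_sub_mul, ← Complex.ofReal_one, ← Complex.ofReal_sub]
      congr 2
      field_simp
      ring
    rw [h1, norm_mul, Complex.norm_real, Real.norm_of_nonneg (by positivity), div_mul_eq_mul_div,
      div_le_iff₀ hpos]
    nlinarith [norm_nonneg (k x)]
  have hAu : A u = A (u - ψ k ξ) + A (ψ (k - e * k) ξ) + A (ψ e (ψ k ξ - u)) := by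
    simp [map_sub, h e, map_mul]
  have b1 : ‖A (u - ψ k ξ)‖ ≤ ‖A‖ * δ :=
    (A.le_opNorm _).trans (mul_le_mul_of_nonneg_left hk.le (norm_nonneg _))
  have b2 : ‖A (ψ (k - e * k) ξ)‖ ≤ ‖A‖ * δ := by
    refine (A.le_opNorm _).trans (mul_le_mul_of_nonneg_left ?_ (norm_nonneg _))
    refine ((ψ (k - e * k)).le_opNorm ξ).trans ?_
    calc ‖ψ (k - e * k)‖ * ‖ξ‖ ≤ η * (‖ξ‖ + 1) := by
          gcongr
          · exact (norm_rep_le ψ _).trans he2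
          · linarith
      _ = δ := by rw [hη]; field_simp
  have b3 : ‖A (ψ e (ψ k ξ - u))‖ ≤ ‖A‖ * δ := by
    refine (A.le_opNorm _).trans (mul_le_mul_of_nonneg_left ?_ (norm_nonneg _))
    refine ((ψ e).le_opNorm _).trans ?_
    rw [norm_sub_rev]
    calc ‖ψ e‖ * ‖u - ψ k ξ‖ ≤ 1 * δ := by
          gcongr
          exact (norm_rep_le ψ _).trans he1
      _ = δ := one_mul δ
  rw [hAu]
  refine (norm_add₃_le).trans ?_
  linarith

lemma HasFinitePropagation.mul {ψ : C₀(X, ℂ) →⋆ₙₐ[ℂ] (E →L[ℂ] E)} (hψ : IsNondegenerate ψ)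
    {S T : E →L[ℂ] E} (hS : HasFinitePropagation ψ S) (hT : HasFinitePropagation ψ T) :
    HasFinitePropagation ψ (S * T) := by
  obtain ⟨R, hR, h⟩ := hS
  obtain ⟨R', hR', h'⟩ := hT
  refine ⟨R + R' + 3, by positivity, fun f g hfg => ?_⟩
  rcases (tsupport f).eq_empty_or_nonempty with hf | hf
  · have : f = 0 := by
      ext x
      exact congrFun (tsupport_eq_empty_iff.1 hf) x
    simp [this]
  ext ξ
  have : (ψ f * S) (T (ψ g ξ)) = 0 := by
    refine hψ.apply_eq_zero _ _ fun e => ?_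
    let φ : C(X, ℝ) := ⟨fun x => max 0 (min 1 (R + 2 - Metric.infDist x (tsupport f))), by fun_prop⟩
    have hφ : ∀ x, |φ x| ≤ 1 := fun x => by
      rw [abs_of_nonneg (le_max_left _ _)]
      exact max_le zero_le_one (min_le_left _ _)
    have h1 : ψ f * S * ψ (e - bddMul φ hφ e) = 0 := by
      apply h
      refine ofReal_lt_setDist (S := R + 1) (by linarith) (by linarith) fun x hx y hy => ?_
      have hcl : IsClosed {y | R + 1 ≤ Metric.infDist y (tsupport f)} :=
        isClosed_le continuous_const (Metric.continuous_infDist_pt _)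
      have hsub : tsupport (e - bddMul φ hφ e : C₀(X, ℂ)) ⊆
          {y | R + 1 ≤ Metric.infDist y (tsupport f)} := by
        refine closure_minimal (fun y hy => ?_) hcl
        by_contra hlt
        simp only [Set.mem_ofPred_eq, not_le] at hlt
        apply hy
        have : φ y = 1 := by
          change max 0 (min 1 (R + 2 - Metric.infDist y (tsupport f))) = 1
          rw [min_eq_left (by linarith), max_eq_right zero_le_one]
        change e y - (φ y : ℂ) * e y = 0
        simp [this]
      rw [dist_comm]
      exact (hsub hy).trans (Metric.infDist_le_dist_of_mem hx)
    have h2 : ψ (bddMul φ hφ e) * T * ψ g = 0 := by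
      apply h'
      refine ofReal_lt_setDist (S := R' + 1) (by linarith) (by linarith) fun x hx y hy => ?_
      have hcl : IsClosed {y | Metric.infDist y (tsupport f) ≤ R + 2} :=
        isClosed_le (Metric.continuous_infDist_pt _) continuous_const
      have hsub : tsupport (bddMul φ hφ e : C₀(X, ℂ)) ⊆
          {y | Metric.infDist y (tsupport f) ≤ R + 2} := by
        refine closure_minimal (fun y hy => ?_) hcl
        by_contra hlt
        simp only [Set.mem_ofPred_eq, not_le] at hlt
        apply hy
        have : φ y = 0 := by
          change max 0 (min 1 (R + 2 - Metric.infDist y (tsupport f))) = 0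
          exact max_eq_left ((min_le_right _ _).trans (by linarith))
        change (φ y : ℂ) * e y = 0
        simp [this]
      have hx' : Metric.infDist x (tsupport f) ≤ R + 2 := hsub hx
      have hy' : R + R' + 3 ≤ Metric.infDist y (tsupport f) :=
        (Metric.le_infDist hf).2 fun z hz => by
          rw [dist_comm]
          exact (lt_dist_of_ofReal_lt_setDist hfg hz hy).le
      have := Metric.infDist_le_infDist_add_dist (s := tsupport f) (x := y) (y := x)
      rw [dist_comm] at this
      linarith
    have e1 := congrArg (fun W : E →L[ℂ] E => W (T (ψ g ξ))) h1
    have e2 := congrArg (fun W : E →L[ℂ] E => W ξ) h2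
    simp only [map_sub, mul_sub, sub_apply, mul_apply_eq_comp,
      zero_apply] at e1 e2 ⊢
    rw [e2, map_zero, map_zero, sub_zero] at e1
    exact e1
  simpa using this

/-- The `*`-algebra of locally compact operators of finite propagation. -/
def finitePropagationAlgebra (ψ : C₀(X, ℂ) →⋆ₙₐ[ℂ] (E →L[ℂ] E)) (hψ : IsNondegenerate ψ) :
    NonUnitalStarSubalgebra ℂ (E →L[ℂ] E) where
  carrier := {T | IsLocallyCompactOp ψ T ∧ HasFinitePropagation ψ T}
  add_mem' hS hT := ⟨hS.1.add hT.1, hS.2.add hT.2⟩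
  zero_mem' := ⟨fun f => by simpa using isCompactOperator_zero, 1, one_pos, by simp⟩
  mul_mem' hS hT := ⟨hS.1.mul hT.1, hS.2.mul hψ hT.2⟩
  smul_mem' c _ hT := ⟨hT.1.smul c, hT.2.smul c⟩
  star_mem' hT := ⟨hT.1.star, hT.2.star⟩

/-- The Roe algebra `C*(X, E)`: the norm closure of the `*`-algebra of locally compact operators of
finite propagation. -/
def roeAlgebra (ψ : C₀(X, ℂ) →⋆ₙₐ[ℂ] (E →L[ℂ] E)) (hψ : IsNondegenerate ψ) :
    NonUnitalStarSubalgebra ℂ (E →L[ℂ] E) :=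
  (finitePropagationAlgebra ψ hψ).topologicalClosure

end Roe

/-! ## Discrete metric spaces and their Roe algebras -/

/-- A metric space is uniformly discrete if `inf {d(x, y) : x ≠ y} > 0`. -/
class IsUniformlyDiscrete (D : Type*) [MetricSpace D] : Prop where
  exists_pos_le_dist : ∃ δ : ℝ, 0 < δ ∧ ∀ x y : D, x ≠ y → δ ≤ dist x y

/-- A discrete metric space has bounded geometry if, for each `R > 0`, the number of points in
balls of radius `R` is uniformly bounded. -/
class HasBoundedGeometry (D : Type*) [MetricSpace D] : Prop where
  exists_encard_closedBall_le : ∀ R : ℝ, 0 < R →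
    ∃ N : ℕ, ∀ x : D, (Metric.closedBall x R).encard ≤ N

instance (D : Type*) [MetricSpace D] [h : IsUniformlyDiscrete D] : DiscreteTopology D := by
  obtain ⟨δ, hδ, h⟩ := h.exists_pos_le_dist
  refine discreteTopology_iff_isOpen_singleton.2 fun x => Metric.isOpen_iff.2 ?_
  rintro _ rfl
  refine ⟨δ, hδ, fun y hy => ?_⟩
  by_contra hne
  exact absurd (h _ _ hne) (not_le.2 hy)

/-- The Hilbert space `L²(D) ⊗ H` (for the counting measure on `D`), as the space `ℓ²(D; H)` of
square-summable functions from `D` to `H`. -/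
abbrev L2 (D H : Type*) [NormedAddCommGroup H] : Type _ := lp (fun _ : D => H) 2

lemma sum_single_apply {D : Type*} [DecidableEq D] {H : Type*} [NormedAddCommGroup H]
    (F : Finset D) (u : D → H) (x : D) :
    (∑ y ∈ F, lp.single 2 y (u y) : L2 D H) x = if x ∈ F then u x else 0 := by
  rw [lp.coeFn_sum, Finset.sum_apply]
  simp [lp.single_apply, Pi.single_apply]

section Discrete

variable (D : Type*) [MetricSpace D]
  (H : Type*) [NormedAddCommGroup H] [InnerProductSpace ℂ H]

variable {D}

/-- The operator on `ℓ²(D; H)` of multiplication by `f ∈ C₀(D)`. -/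
def mulOp (f : C₀(D, ℂ)) : L2 D H →L[ℂ] L2 D H :=
  LinearMap.mkContinuous
    { toFun := fun v => ⟨fun x => f x • v x, by
        have hb : ∀ x, ‖f x • v x‖ ≤ ‖(‖f‖ : ℂ) • v x‖ := fun x => by
          rw [norm_smul, norm_smul, Complex.norm_real, norm_norm]
          gcongr
          exact f.toBCF.norm_coe_le_norm x
        exact ((lp.memℓp v).const_smul (‖f‖ : ℂ)).mono' hb⟩
      map_add' := fun u v => by ext x; exact smul_add _ _ _
      map_smul' := fun c v => by ext x; exact smul_comm _ _ _ }
    ‖f‖ fun v => by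
      have hv : ‖(‖f‖ : ℂ) • v‖ = ‖f‖ * ‖v‖ := by
        rw [norm_smul, Complex.norm_real, norm_norm]
      rw [← hv]
      refine lp.norm_mono (by norm_num) fun x => ?_
      change ‖f x • v x‖ ≤ ‖(‖f‖ : ℂ) • v x‖
      rw [norm_smul, norm_smul, Complex.norm_real, norm_norm]
      gcongr
      exact f.toBCF.norm_coe_le_norm x

@[simp] lemma mulOp_apply (f : C₀(D, ℂ)) (v : L2 D H) (x : D) : mulOp H f v x = f x • v x := rfl

variable (D) [CompleteSpace H]

/-- The standard action of `C₀(D)` on `ℓ²(D; H)` by multiplication. -/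
def mulRep : C₀(D, ℂ) →⋆ₙₐ[ℂ] (L2 D H →L[ℂ] L2 D H) where
  toFun := mulOp H
  map_smul' c f := by ext v x; simp [mul_smul]
  map_zero' := by ext v x; simp
  map_add' f g := by ext v x; simp [add_smul]
  map_mul' f g := by ext v x; simp [mul_smul]
  map_star' f := by
    rw [ContinuousLinearMap.star_eq_adjoint, ContinuousLinearMap.eq_adjoint_iff]
    intro u v
    rw [lp.inner_eq_tsum, lp.inner_eq_tsum]
    congr 1
    ext x
    simp [inner_smul_left, inner_smul_right]

@[simp] lemma mulRep_apply (f : C₀(D, ℂ)) (v : L2 D H) (x : D) :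
    mulRep D H f v x = f x • v x := rfl

variable {D}

/-- The function that agrees with `f` on the finite set `F` and vanishes elsewhere. -/
def restrictFinset [DiscreteTopology D] (f : D → ℂ) (F : Finset D) : C₀(D, ℂ) where
  toFun := (F : Set D).indicator f
  continuous_toFun := continuous_of_discreteTopology
  zero_at_infty' := by
    refine tendsto_nhds_of_eventually_eq ?_
    rw [Filter.cocompact_eq_cofinite]
    filter_upwards [F.finite_toSet.compl_mem_cofinite] with x hx
    exact Set.indicator_of_notMem hx f

variable (D)

lemma isNondegenerate_mulRep [DiscreteTopology D] : IsNondegenerate (mulRep D H) := by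
  classical
  intro v
  refine mem_closure_of_tendsto (lp.hasSum_single (by norm_num) v) (Filter.Eventually.of_forall ?_)
  intro F
  refine ⟨restrictFinset 1 F, v, ?_⟩
  ext x
  rw [mulRep_apply, sum_single_apply]
  by_cases hx : x ∈ F <;> simp [restrictFinset, hx]

variable [DiscreteTopology D]

/-- The Roe algebra `C*_H(D)` of operators on `ℓ²(D; H)`. For `H = ℂ` it is the uniform Roe algebra
of `D`, for infinite-dimensional `H` it is the Roe algebra of `D`. -/
abbrev RoeAlg : NonUnitalStarSubalgebra ℂ (L2 D H →L[ℂ] L2 D H) :=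
  roeAlgebra (mulRep D H) (isNondegenerate_mulRep D H)

lemma isCompactOperator_mulRep (f : C₀(D, ℂ)) : IsCompactOperator (mulRep D ℂ f) := by
  classical
  have hcl := isClosed_setOfPred_isCompactOperator (𝕜₁ := ℂ) (𝕜₂ := ℂ) (σ₁₂ := RingHom.id ℂ)
    (M₁ := L2 D ℂ) (M₂ := L2 D ℂ)
  refine hcl.closure_subset (Metric.mem_closure_iff.2 fun ε hε => ?_)
  have hfin : {x | ε / 2 ≤ ‖f x‖}.Finite := by
    have h := f.zero_at_infty'.norm
    rw [Filter.cocompact_eq_cofinite, norm_zero] at h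
    have := h.eventually (gt_mem_nhds (half_pos hε))
    rw [Filter.eventually_cofinite] at this
    simpa using this
  refine ⟨mulRep D ℂ (restrictFinset f hfin.toFinset), ?_, ?_⟩
  · have heq : mulRep D ℂ (restrictFinset f hfin.toFinset) = ∑ x ∈ hfin.toFinset,
        (lp.singleContinuousLinearMap ℂ (fun _ : D => ℂ) 2 x) ∘L
          (f x • lp.evalCLM ℂ (fun _ : D => ℂ) 2 x) := by
      ext v x
      rw [sum_apply, mulRep_apply]
      refine Eq.trans ?_ (sum_single_apply hfin.toFinset (fun y => f y • v y) x).symm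
      by_cases hx : x ∈ hfin.toFinset
      · rw [if_pos hx]
        congr 1
        exact Set.indicator_of_mem hx _
      · rw [if_neg hx]
        have : restrictFinset (f : D → ℂ) hfin.toFinset x = 0 := Set.indicator_of_notMem hx _
        rw [this, zero_smul]
    change IsCompactOperator (mulRep D ℂ (restrictFinset f hfin.toFinset))
    rw [heq]
    refine Submodule.sum_mem (compactOperator (RingHom.id ℂ) (L2 D ℂ) (L2 D ℂ)) fun x _ => ?_
    exact IsCompactOperator.comp_clm (f := lp.singleContinuousLinearMap ℂ (fun _ : D => ℂ) 2 x)
      (isCompactOperator_of_locallyCompactSpace_rng _) (f x • lp.evalCLM ℂ (fun _ : D => ℂ) 2 x)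
  · rw [dist_eq_norm, ← map_sub]
    refine (norm_rep_le _ _).trans_lt (lt_of_le_of_lt ?_ (half_lt_self hε))
    rw [← ZeroAtInftyContinuousMap.norm_toBCF_eq_norm,
      BoundedContinuousFunction.norm_le (half_pos hε).le]
    intro x
    change ‖f x - ((hfin.toFinset : Set D).indicator f) x‖ ≤ ε / 2
    by_cases hx : x ∈ hfin.toFinset
    · rw [Set.indicator_of_mem hx, sub_self, norm_zero]
      positivity
    · rw [Set.indicator_of_notMem hx, sub_zero]
      simp only [Set.Finite.mem_toFinset, Set.mem_ofPred_eq, not_le] at hx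
      exact hx.le

lemma one_mem_uniformRoe : (1 : L2 D ℂ →L[ℂ] L2 D ℂ) ∈ RoeAlg D ℂ := by
  refine NonUnitalStarSubalgebra.le_topologicalClosure _ ⟨fun f => ?_, 1, one_pos, fun f g hfg => ?_⟩
  · rw [one_mul, mul_one]
    exact ⟨isCompactOperator_mulRep D f, isCompactOperator_mulRep D f⟩
  · rw [mul_one, ← map_mul]
    have : f * g = 0 := by
      ext x
      by_contra hx
      have hf : x ∈ tsupport f := subset_closure fun h => hx (by simp [h])
      have hg : x ∈ tsupport g := subset_closure fun h => hx (by simp [h])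
      have := lt_dist_of_ofReal_lt_setDist hfg hf hg
      rw [dist_self] at this
      linarith
    rw [this, map_zero]

/-- The unit of the uniform Roe algebra. -/
def uniformRoeOne : RoeAlg D ℂ := ⟨1, one_mem_uniformRoe D⟩

variable {H}

/-- The isometry `V_D = id ⊗ V : ℓ²(D) → ℓ²(D; H)` given by an isometry `V : ℂ → H`. -/
def isoD (V : ℂ →ₗᵢ[ℂ] H) : L2 D ℂ →ₗᵢ[ℂ] L2 D H where
  toFun v := ⟨fun x => V (v x), (lp.memℓp v).mono' fun x => (V.norm_map _).le⟩
  map_add' u v := by ext x; exact map_add V _ _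
  map_smul' c v := by ext x; exact map_smul V _ _
  norm_map' v := le_antisymm
    (lp.norm_mono (by norm_num) fun x => (V.norm_map _).le)
    (lp.norm_mono (by norm_num) fun x => (V.norm_map _).ge)

lemma adjoint_apply_iso {E F : Type*} [NormedAddCommGroup E] [InnerProductSpace ℂ E]
    [CompleteSpace E] [NormedAddCommGroup F] [InnerProductSpace ℂ F] [CompleteSpace F]
    (W : E →ₗᵢ[ℂ] F) (v : E) :
    ContinuousLinearMap.adjoint W.toContinuousLinearMap (W v) = v := by
  refine ext_inner_right ℂ fun w => ?_
  rw [ContinuousLinearMap.adjoint_inner_left]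
  exact W.inner_map_map v w

/-- `T ↦ W T W*`. -/
def conjIso {E F : Type*} [NormedAddCommGroup E] [InnerProductSpace ℂ E] [CompleteSpace E]
    [NormedAddCommGroup F] [InnerProductSpace ℂ F] [CompleteSpace F] (W : E →ₗᵢ[ℂ] F) :
    (E →L[ℂ] E) →⋆ₙₐ[ℂ] (F →L[ℂ] F) where
  toFun T := W.toContinuousLinearMap ∘L T ∘L ContinuousLinearMap.adjoint W.toContinuousLinearMap
  map_smul' c T := by ext v; simp
  map_zero' := by ext v; simp
  map_add' S T := by ext v; simp
  map_mul' S T := by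
    ext v
    simp [adjoint_apply_iso]
  map_star' T := by
    simp only [ContinuousLinearMap.star_eq_adjoint, ContinuousLinearMap.adjoint_comp,
      ContinuousLinearMap.adjoint_adjoint, ContinuousLinearMap.comp_assoc]

lemma conjIso_mem (V : ℂ →ₗᵢ[ℂ] H) {T : L2 D ℂ →L[ℂ] L2 D ℂ} (hT : T ∈ RoeAlg D ℂ) :
    conjIso (isoD D V) T ∈ RoeAlg D H := by
  set W := isoD D V
  have hc : Continuous (conjIso W) :=
    AddMonoidHomClass.continuous_of_bound (conjIso W) 1 fun T => by
      rw [one_mul]; exact NonUnitalStarAlgHom.norm_apply_le _ T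
  have h1 : ∀ f : C₀(D, ℂ), mulRep D H f ∘L W.toContinuousLinearMap =
      W.toContinuousLinearMap ∘L mulRep D ℂ f := fun f => by
    ext v x
    change f x • V (v x) = V (f x • v x)
    rw [map_smul]
  have h2 : ∀ f : C₀(D, ℂ), ContinuousLinearMap.adjoint W.toContinuousLinearMap ∘L mulRep D H f =
      mulRep D ℂ f ∘L ContinuousLinearMap.adjoint W.toContinuousLinearMap := fun f => by
    have := congrArg ContinuousLinearMap.adjoint (h1 (star f))
    simp only [ContinuousLinearMap.adjoint_comp, map_star, ContinuousLinearMap.star_eq_adjoint,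
      ContinuousLinearMap.adjoint_adjoint] at this
    exact this
  have h3 : ∀ (f : C₀(D, ℂ)) (S : L2 D ℂ →L[ℂ] L2 D ℂ),
      mulRep D H f * conjIso W S = conjIso W (mulRep D ℂ f * S) := fun f S => by
    change mulRep D H f ∘L (W.toContinuousLinearMap ∘L (S ∘L _)) =
      W.toContinuousLinearMap ∘L ((mulRep D ℂ f ∘L S) ∘L _)
    rw [← ContinuousLinearMap.comp_assoc, h1]
    rfl
  have h4 : ∀ (f : C₀(D, ℂ)) (S : L2 D ℂ →L[ℂ] L2 D ℂ),
      conjIso W S * mulRep D H f = conjIso W (S * mulRep D ℂ f) := fun f S => by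
    change (W.toContinuousLinearMap ∘L (S ∘L _)) ∘L mulRep D H f =
      W.toContinuousLinearMap ∘L ((S ∘L mulRep D ℂ f) ∘L _)
    rw [ContinuousLinearMap.comp_assoc, ContinuousLinearMap.comp_assoc, h2]
    rfl
  have hK : ∀ S : L2 D ℂ →L[ℂ] L2 D ℂ, IsCompactOperator S → IsCompactOperator (conjIso W S) :=
    fun S hS => (hS.comp_clm (ContinuousLinearMap.adjoint W.toContinuousLinearMap)).clm_comp
      W.toContinuousLinearMap
  refine map_mem_closure hc hT fun S hS => ⟨fun f => ?_, ?_⟩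
  · rw [h3, h4]
    exact ⟨hK _ (hS.1 f).1, hK _ (hS.1 f).2⟩
  · obtain ⟨R, hR, h⟩ := hS.2
    refine ⟨R, hR, fun f g hfg => ?_⟩
    rw [h3, h4, h f g hfg, map_zero]

/-- The `*`-homomorphism `i_D : C*_ℂ(D) → C*_H(D)`, `T ↦ V_D T V_D*`. -/
def iD (V : ℂ →ₗᵢ[ℂ] H) : RoeAlg D ℂ →⋆ₙₐ[ℂ] RoeAlg D H :=
  NonUnitalStarAlgHom.codRestrict
    ((conjIso (isoD D V)).comp (NonUnitalStarSubalgebraClass.subtype (RoeAlg D ℂ))) (RoeAlg D H)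
    fun T => conjIso_mem D V T.2

end Discrete

/-! ## K-theory -/

section KTheory

open Matrix

section Unital

variable {A : Type*} [Ring A] [StarRing A]
  {k l m n : Type*} [Fintype k] [Fintype l] [Fintype m] [Fintype n]

/-- Murray–von Neumann equivalence of two projections in matrix algebras over `A` (possibly of
different sizes): `p = v* v` and `q = v v*` for a rectangular matrix `v`. -/
def MvN (p : Matrix m m A) (q : Matrix n n A) : Prop :=
  ∃ v : Matrix n m A, vᴴ * v = p ∧ v * vᴴ = q

lemma MvN.refl {p : Matrix m m A} (hp : IsStarProjection p) : MvN p p := by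
  refine ⟨p, ?_, ?_⟩ <;>
  · rw [← star_eq_conjTranspose, hp.isSelfAdjoint.star_eq]
    exact hp.isIdempotentElem

lemma MvN.symm {p : Matrix m m A} {q : Matrix n n A} : MvN p q → MvN q p := by
  rintro ⟨v, rfl, rfl⟩
  exact ⟨vᴴ, by simp, by simp⟩

lemma MvN.trans {p : Matrix m m A} {q : Matrix n n A} {r : Matrix l l A}
    (hp : IsStarProjection p) (hr : IsStarProjection r) :
    MvN p q → MvN q r → MvN p r := by
  rintro ⟨v, rfl, hv⟩ ⟨w, hw, rfl⟩
  refine ⟨w * v, ?_, ?_⟩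
  · have h := hp.isIdempotentElem.eq
    rw [conjTranspose_mul, Matrix.mul_assoc, ← Matrix.mul_assoc wᴴ, hw, ← hv, ← h]
    simp only [Matrix.mul_assoc]
  · have h := hr.isIdempotentElem.eq
    rw [conjTranspose_mul, Matrix.mul_assoc, ← Matrix.mul_assoc v, hv, ← hw, ← h]
    simp only [Matrix.mul_assoc]

lemma MvN.reindex {p : Matrix m m A} (hp : IsStarProjection p) (e : m ≃ n) :
    MvN p (Matrix.reindex e e p) := by
  have h1 : pᴴ = p := hp.isSelfAdjoint
  have h2 : p * p = p := hp.isIdempotentElem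
  refine ⟨p.submatrix e.symm id, ?_, ?_⟩
  · rw [conjTranspose_submatrix, h1, submatrix_mul_equiv (e₂ := e.symm), h2, submatrix_id_id]
  · rw [conjTranspose_submatrix, h1,
      ← submatrix_mul _ _ _ _ _ Function.bijective_id, h2]
    rfl

lemma MvN.fromBlocks {p : Matrix m m A} {q : Matrix n n A} {p' : Matrix k k A} {q' : Matrix l l A} :
    MvN p q → MvN p' q' → MvN (Matrix.fromBlocks p 0 0 p') (Matrix.fromBlocks q 0 0 q') := by
  rintro ⟨v, rfl, rfl⟩ ⟨w, rfl, rfl⟩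
  exact ⟨Matrix.fromBlocks v 0 0 w, by simp [fromBlocks_conjTranspose, fromBlocks_multiply],
    by simp [fromBlocks_conjTranspose, fromBlocks_multiply]⟩

lemma isStarProjection_fromBlocks {p : Matrix m m A} {q : Matrix n n A}
    (hp : IsStarProjection p) (hq : IsStarProjection q) :
    IsStarProjection (Matrix.fromBlocks p 0 0 q) := by
  have h1 : pᴴ = p := hp.isSelfAdjoint
  have h2 : qᴴ = q := hq.isSelfAdjoint
  have h3 : p * p = p := hp.isIdempotentElem
  have h4 : q * q = q := hq.isIdempotentElem
  constructor
  · simp [IsIdempotentElem, fromBlocks_multiply, h3, h4]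
  · simp [IsSelfAdjoint, star_eq_conjTranspose, fromBlocks_conjTranspose, h1, h2]

lemma isStarProjection_reindex {p : Matrix m m A} (hp : IsStarProjection p) (e : m ≃ n) :
    IsStarProjection (Matrix.reindex e e p) := by
  have h1 : pᴴ = p := hp.isSelfAdjoint
  have h3 : p * p = p := hp.isIdempotentElem
  constructor
  · rw [IsIdempotentElem, reindex_apply, submatrix_mul_equiv, h3]
  · rw [IsSelfAdjoint, star_eq_conjTranspose, reindex_apply, conjTranspose_submatrix, h1]

variable (A) in
/-- Projections in the matrix algebras `Mₙ(A)`, `n ∈ ℕ`. -/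
structure MatProj where
  /-- the size -/
  size : ℕ
  /-- the matrix -/
  mat : Matrix (Fin size) (Fin size) A
  isProj : IsStarProjection mat

namespace MatProj

/-- Block sum `p ⊕ q = diag(p, q)`. -/
def add (p q : MatProj A) : MatProj A where
  size := p.size + q.size
  mat := Matrix.reindex finSumFinEquiv finSumFinEquiv (Matrix.fromBlocks p.mat 0 0 q.mat)
  isProj := isStarProjection_reindex (isStarProjection_fromBlocks p.isProj q.isProj) _

variable (A) in
/-- Murray–von Neumann equivalence as a setoid. -/
instance setoid : Setoid (MatProj A) where
  r p q := MvN p.mat q.mat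
  iseqv := ⟨fun p => MvN.refl p.isProj, MvN.symm, fun {p _ r} => MvN.trans p.isProj r.isProj⟩

lemma equiv_iff {p q : MatProj A} : p ≈ q ↔ MvN p.mat q.mat := Iff.rfl

lemma add_mat (p q : MatProj A) : MvN (Matrix.fromBlocks p.mat 0 0 q.mat) (p.add q).mat :=
  MvN.reindex (isStarProjection_fromBlocks p.isProj q.isProj) _

end MatProj

variable (A) in
/-- The monoid `V(A)` of Murray–von Neumann classes of projections in matrix algebras over `A`. -/
def ProjMonoid : Type _ := Quotient (MatProj.setoid A)

namespace ProjMonoid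

/-- The class of a projection. -/
def mk (p : MatProj A) : ProjMonoid A := Quotient.mk _ p

lemma mk_eq_mk {p q : MatProj A} : mk p = mk q ↔ MvN p.mat q.mat := Quotient.eq

instance : Add (ProjMonoid A) where
  add := Quotient.map₂ MatProj.add fun p p' h q q' h' =>
    ((p.add_mat q).symm.trans (p.add q).isProj
      (isStarProjection_fromBlocks p'.isProj q'.isProj) (h.fromBlocks h')).trans
      (p.add q).isProj (p'.add q').isProj (p'.add_mat q')

instance : Zero (ProjMonoid A) where
  zero := mk ⟨0, 0, .zero _⟩

lemma mk_add_mk (p q : MatProj A) : mk p + mk q = mk (p.add q) := rfl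

/-- A class depends only on a projection matrix up to reindexing. -/
lemma mk_eq_mk_of_reindex {p q : MatProj A} {P : Matrix m m A} {Q : Matrix n n A}
    (hP : IsStarProjection P) (hQ : IsStarProjection Q) (hp : MvN P p.mat) (hq : MvN Q q.mat)
    (e : m ≃ n) (he : Matrix.reindex e e P = Q) : mk p = mk q := by
  subst he
  exact mk_eq_mk.2 ((hp.symm.trans p.isProj hQ (MvN.reindex hP e)).trans p.isProj q.isProj hq)

protected lemma add_assoc (a b c : ProjMonoid A) : a + b + c = a + (b + c) := by
  obtain ⟨p⟩ := a
  obtain ⟨q⟩ := b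
  obtain ⟨r⟩ := c
  have h1 := isStarProjection_fromBlocks p.isProj q.isProj
  have h2 := isStarProjection_fromBlocks q.isProj r.isProj
  have h1' := isStarProjection_fromBlocks (p.add q).isProj r.isProj
  have h2' := isStarProjection_fromBlocks p.isProj (q.add r).isProj
  refine mk_eq_mk_of_reindex (p := (p.add q).add r) (q := p.add (q.add r))
    (isStarProjection_fromBlocks h1 r.isProj) (isStarProjection_fromBlocks p.isProj h2)
    ?_ ?_ (Equiv.sumAssoc _ _ _) ?_
  · exact (((p.add_mat q).fromBlocks (MvN.refl r.isProj)).trans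
      (isStarProjection_fromBlocks h1 r.isProj) ((p.add q).add r).isProj ((p.add q).add_mat r))
  · exact (((MvN.refl p.isProj).fromBlocks (q.add_mat r)).trans
      (isStarProjection_fromBlocks p.isProj h2) (p.add (q.add r)).isProj (p.add_mat (q.add r)))
  · ext (i | i | i) (j | j | j) <;> rfl

protected lemma add_comm (a b : ProjMonoid A) : a + b = b + a := by
  obtain ⟨p⟩ := a
  obtain ⟨q⟩ := b
  refine mk_eq_mk_of_reindex (p := p.add q) (q := q.add p)
    (isStarProjection_fromBlocks p.isProj q.isProj)
    (isStarProjection_fromBlocks q.isProj p.isProj)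
    (p.add_mat q) (q.add_mat p) (Equiv.sumComm _ _) ?_
  ext (i | i) (j | j) <;> rfl

protected lemma zero_add (a : ProjMonoid A) : 0 + a = a := by
  obtain ⟨p⟩ := a
  refine mk_eq_mk_of_reindex (p := MatProj.add ⟨0, 0, .zero _⟩ p) (q := p)
    (isStarProjection_fromBlocks (.zero _) p.isProj) p.isProj
    (MatProj.add_mat ⟨0, 0, .zero _⟩ p) (MvN.refl p.isProj) (Equiv.emptySum (Fin 0) _) ?_
  ext i j
  rfl

instance : AddCommMonoid (ProjMonoid A) where
  add_assoc := ProjMonoid.add_assoc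
  zero_add := ProjMonoid.zero_add
  add_zero a := by rw [ProjMonoid.add_comm, ProjMonoid.zero_add]
  add_comm := ProjMonoid.add_comm
  nsmul := nsmulRec

end ProjMonoid

variable (A) in
/-- `K₀₀(A)`: the Grothendieck group of `V(A)`. For a unital C*-algebra `A` this is `K₀(A)`. -/
abbrev K00 : Type _ := Algebra.GrothendieckAddGroup (ProjMonoid A)

/-- The class of a projection in a matrix algebra. -/
def K00.mk (p : MatProj A) : K00 A := Algebra.GrothendieckAddGroup.of (ProjMonoid.mk p)

end Unital

section Functoriality

variable {A B : Type*} [Ring A] [StarRing A] [Algebra ℂ A] [Ring B] [StarRing B] [Algebra ℂ B]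

/-- A `*`-homomorphism applied to the entries of a projection. -/
def MatProj.map (φ : A →⋆ₐ[ℂ] B) (p : MatProj A) : MatProj B where
  size := p.size
  mat := p.mat.map φ
  isProj := by
    have h1 : p.matᴴ = p.mat := p.isProj.isSelfAdjoint
    have h3 : p.mat * p.mat = p.mat := p.isProj.isIdempotentElem
    constructor
    · rw [IsIdempotentElem, ← Matrix.map_mul, h3]
    · rw [IsSelfAdjoint, star_eq_conjTranspose, ← conjTranspose_map _ (map_star φ), h1]

lemma MvN.map {m n : Type*} [Fintype m] [Fintype n] (φ : A →⋆ₐ[ℂ] B) {p : Matrix m m A}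
    {q : Matrix n n A} : MvN p q → MvN (p.map φ) (q.map φ) := by
  rintro ⟨v, rfl, rfl⟩
  refine ⟨v.map φ, ?_, ?_⟩ <;>
  rw [← conjTranspose_map _ (map_star φ), ← Matrix.map_mul]

/-- The map `V(A) → V(B)` induced by a `*`-homomorphism. -/
def ProjMonoid.map (φ : A →⋆ₐ[ℂ] B) : ProjMonoid A →+ ProjMonoid B where
  toFun := Quotient.map (MatProj.map φ) fun _ _ h => MvN.map φ h
  map_zero' := by
    refine ProjMonoid.mk_eq_mk.2 ⟨0, ?_, ?_⟩ <;> ext i <;> exact i.elim0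
  map_add' := by
    rintro ⟨p⟩ ⟨q⟩
    refine congrArg (Quotient.mk _) ?_
    unfold MatProj.map MatProj.add
    congr 1
    change (Matrix.reindex finSumFinEquiv finSumFinEquiv (fromBlocks p.mat 0 0 q.mat)).map φ =
      Matrix.reindex finSumFinEquiv finSumFinEquiv (fromBlocks (p.mat.map φ) 0 0 (q.mat.map φ))
    rw [reindex_apply, reindex_apply, ← submatrix_map, fromBlocks_map]
    simp

/-- The map `K₀₀(A) → K₀₀(B)` induced by a `*`-homomorphism. -/
def K00.map (φ : A →⋆ₐ[ℂ] B) : K00 A →+ K00 B :=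
  Algebra.GrothendieckAddGroup.lift (Algebra.GrothendieckAddGroup.of.comp (ProjMonoid.map φ))

lemma K00.map_mk (φ : A →⋆ₐ[ℂ] B) (p : MatProj A) : K00.map φ (K00.mk p) = K00.mk (p.map φ) :=
  DFunLike.congr_fun (Algebra.GrothendieckAddGroup.lift.symm_apply_apply
    (Algebra.GrothendieckAddGroup.of.comp (ProjMonoid.map φ))) (ProjMonoid.mk p)

lemma K00.map_comp {C : Type*} [Ring C] [StarRing C] [Algebra ℂ C] (ψ : B →⋆ₐ[ℂ] C)
    (φ : A →⋆ₐ[ℂ] B) (x : K00 A) : K00.map (ψ.comp φ) x = K00.map ψ (K00.map φ x) := by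
  refine DFunLike.congr_fun (g := (K00.map ψ).comp (K00.map φ))
    (Algebra.GrothendieckAddGroup.lift.symm.injective ?_) x
  ext ⟨p⟩
  change K00.map (ψ.comp φ) (K00.mk p) = K00.map ψ (K00.map φ (K00.mk p))
  rw [K00.map_mk, K00.map_mk, K00.map_mk]
  rfl

end Functoriality

section NonUnital

variable (A : Type*) [NonUnitalRing A] [StarRing A] [Module ℂ A] [IsScalarTower ℂ A A]
  [SMulCommClass ℂ A A] [StarModule ℂ A]
  {B : Type*} [NonUnitalRing B] [StarRing B] [Module ℂ B] [IsScalarTower ℂ B B]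
  [SMulCommClass ℂ B B] [StarModule ℂ B]

/-- The quotient map `A⁺ → ℂ` of the unitization `A⁺ = A ⊕ ℂ 1`. -/
def scalarPart : Unitization ℂ A →⋆ₐ[ℂ] ℂ where
  toAlgHom := Unitization.fstHom ℂ A
  map_star' _ := rfl

/-- The group `K₀(A)` of a (possibly nonunital) C*-algebra `A`: the kernel of the map
`K₀₀(A⁺) → K₀₀(ℂ)` induced by the quotient map `A⁺ → ℂ`. -/
def K0 : AddSubgroup (K00 (Unitization ℂ A)) := (K00.map (scalarPart A)).ker

variable {A}

/-- The homomorphism `φ_* : K₀(A) → K₀(B)` induced by a `*`-homomorphism `φ : A → B`. -/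
def K0.map (φ : A →⋆ₙₐ[ℂ] B) : K0 A →+ K0 B :=
  ((K00.map (Unitization.starMap φ)).comp (K0 A).subtype).codRestrict (K0 B) fun x => by
    have h : (scalarPart B).comp (Unitization.starMap φ) = scalarPart A := by
      ext x
      change (Unitization.starMap φ (x : Unitization ℂ A)).fst = (x : Unitization ℂ A).fst
      simp
    change K00.map (scalarPart B) (K00.map (Unitization.starMap φ) x.1) = 0
    rw [← K00.map_comp, h]
    exact x.2

/-- The projection `p ∈ A`, as a `1 × 1` matrix over the unitization. -/
def projMat {p : A} (hp : IsStarProjection p) : MatProj (Unitization ℂ A) where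
  size := 1
  mat := Matrix.of fun _ _ => (p : Unitization ℂ A)
  isProj := by
    constructor
    · refine Matrix.ext fun i j => ?_
      simp [Matrix.mul_apply, ← Unitization.inr_mul, hp.isIdempotentElem.eq]
    · refine Matrix.ext fun i j => ?_
      simp [Matrix.star_apply, ← Unitization.inr_star, hp.isSelfAdjoint.star_eq]

/-- The class `[p] ∈ K₀(A)` of a projection `p ∈ A`. -/
def K0.ofProj {p : A} (hp : IsStarProjection p) : K0 A :=
  ⟨K00.mk (projMat hp), by
    change K00.map (scalarPart A) _ = 0
    rw [K00.map_mk]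
    have : ProjMonoid.mk ((projMat hp).map (scalarPart A)) = 0 := by
      refine ProjMonoid.mk_eq_mk.2 ⟨0, ?_, ?_⟩
      · refine Matrix.ext fun i j => ?_
        change _ = (p : Unitization ℂ A).fst
        rw [Unitization.fst_inr]
        rfl
      · refine Matrix.ext fun i j => i.elim0
    rw [K00.mk, this, map_zero]⟩

end NonUnital

end KTheory

/-! ## The class of the unit -/

section Unit

variable (D : Type*) [MetricSpace D] [DiscreteTopology D]

lemma isStarProjection_uniformRoeOne : IsStarProjection (uniformRoeOne D) :=
  ⟨Subtype.ext (mul_one _), Subtype.ext (star_one _)⟩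

/-- The class `[1]` of the unit in `K₀` of the uniform Roe algebra. -/
def unitClass : K0 (RoeAlg D ℂ) := K0.ofProj (isStarProjection_uniformRoeOne D)

end Unit

/-! ## Borel–Moore homology of graphs -/

section BorelMoore

variable {V : Type*}

/-- Borel–Moore `0`-chains: arbitrary formal sums `∑ λ_x x` over the vertices. -/
abbrev BMChain0 (_G : SimpleGraph V) : Type _ := V → ℤ

/-- Borel–Moore `1`-chains: arbitrary formal sums `∑ λ_e e` over the edges. -/
abbrev BMChain1 (G : SimpleGraph V) : Type _ := G.edgeSet → ℤ

open Classical in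
/-- The coefficient at the vertex `x` of the boundary of an edge: `∂e = (end of e) - (start of e)`.
The edge `e` is oriented by the chosen representative `e.out : V × V` of the unordered pair `e`. -/
def edgeBoundary (e : Sym2 V) (x : V) : ℤ :=
  (if e.out.2 = x then 1 else 0) - (if e.out.1 = x then 1 else 0)

lemma mem_of_edgeBoundary_ne_zero {e : Sym2 V} {x : V} (h : edgeBoundary e x ≠ 0) : x ∈ e := by
  have he : s(e.out.1, e.out.2) = e := Quot.out_eq e
  rw [← he, Sym2.mem_iff]
  by_contra! hx
  exact h (by simp [edgeBoundary, hx.1.symm, hx.2.symm])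

lemma finite_edges_at (G : SimpleGraph V) [∀ x, Finite (G.neighborSet x)] (x : V) :
    {e : G.edgeSet | x ∈ (e : Sym2 V)}.Finite := by
  refine Set.Finite.of_finite_image (f := Subtype.val) ?_ Subtype.val_injective.injOn
  refine ((Set.toFinite (G.neighborSet x)).image (fun y => s(x, y))).subset ?_
  rintro _ ⟨⟨e, he⟩, hx, rfl⟩
  obtain ⟨y, rfl⟩ := hx
  exact ⟨y, he, rfl⟩

lemma finite_support_boundary (G : SimpleGraph V) [∀ x, Finite (G.neighborSet x)]
    (b : BMChain1 G) (x : V) :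
    (Function.support fun e : G.edgeSet => b e * edgeBoundary (e : Sym2 V) x).Finite :=
  (finite_edges_at G x).subset fun _ he =>
    mem_of_edgeBoundary_ne_zero (right_ne_zero_of_mul he)

/-- The boundary map `∂ : C₁^BM(G) → C₀^BM(G)` of a locally finite graph. The sum that gives the
coefficient of `∂b` at a vertex `x` has only finitely many nonzero terms, as only finitely many
edges meet `x`. -/
def bmBoundary (G : SimpleGraph V) [∀ x, Finite (G.neighborSet x)] : BMChain1 G →+ BMChain0 G where
  toFun b x := ∑ᶠ e : G.edgeSet, b e * edgeBoundary (e : Sym2 V) x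
  map_zero' := by ext x; simp
  map_add' b b' := by
    ext x
    simp only [Pi.add_apply, add_mul]
    exact finsum_add_distrib (finite_support_boundary G b x) (finite_support_boundary G b' x)

/-- The `0`-th Borel–Moore homology group `C₀^BM(G) / ∂ C₁^BM(G)` of a locally finite graph. -/
abbrev BMHomology0 (G : SimpleGraph V) [∀ x, Finite (G.neighborSet x)] : Type _ :=
  BMChain0 G ⧸ (bmBoundary G).range

/-- The class in `H₀^BM(G)` of the chain `c` with all coefficients equal to `1`. -/
def bmOnes (G : SimpleGraph V) [∀ x, Finite (G.neighborSet x)] : BMHomology0 G :=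
  QuotientAddGroup.mk (1 : V → ℤ)

lemma range_bmBoundary_mono {G G' : SimpleGraph V} [∀ x, Finite (G.neighborSet x)]
    [∀ x, Finite (G'.neighborSet x)] (h : G ≤ G') :
    (bmBoundary G).range ≤ (bmBoundary G').range := by
  classical
  rintro _ ⟨b, rfl⟩
  refine ⟨fun e => if he : (e : Sym2 V) ∈ G.edgeSet then b ⟨e, he⟩ else 0, ?_⟩
  ext x
  let ι : G.edgeSet → G'.edgeSet := Set.inclusion (SimpleGraph.edgeSet_mono h)
  have hι : Function.Injective ι := Set.inclusion_injective _
  let F : G'.edgeSet → ℤ := fun e =>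
    (if he : (e : Sym2 V) ∈ G.edgeSet then b ⟨e, he⟩ else 0) * edgeBoundary (e : Sym2 V) x
  change ∑ᶠ e : G'.edgeSet, F e = ∑ᶠ e : G.edgeSet, b e * edgeBoundary (e : Sym2 V) x
  have h1 : ∑ᶠ e : G'.edgeSet, F e = ∑ᶠ e ∈ Set.range ι, F e := by
    rw [← finsum_mem_univ]
    refine finsum_mem_inter_support_eq' F _ _ fun e he => ⟨fun _ => ?_, fun _ => trivial⟩
    by_contra hne
    refine he ?_
    have : (e : Sym2 V) ∉ G.edgeSet := fun h' => hne ⟨⟨e, h'⟩, rfl⟩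
    simp [F, this]
  rw [h1, finsum_mem_range hι]
  refine finsum_congr fun e => ?_
  simp [F, ι]

/-- The map `H₀^BM(G) → H₀^BM(G')` induced by the inclusion of a graph `G` in a graph `G'` with the
same vertices: it is the identity on vertices. -/
def bmMap {G G' : SimpleGraph V} [∀ x, Finite (G.neighborSet x)]
    [∀ x, Finite (G'.neighborSet x)] (h : G ≤ G') : BMHomology0 G →+ BMHomology0 G' :=
  QuotientAddGroup.map _ _ (AddMonoidHom.id (V → ℤ)) (range_bmBoundary_mono h)

end BorelMoore

section Rips

variable (D : Type*) [MetricSpace D]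

/-- The graph `D(α)`: its vertices are the points of `D`, and `x ≠ y` are joined by an edge
whenever `d(x, y) ≤ α`. -/
def ripsGraph (α : ℝ) : SimpleGraph D where
  Adj x y := x ≠ y ∧ dist x y ≤ α
  symm := ⟨fun x y h => ⟨h.1.symm, by rw [dist_comm]; exact h.2⟩⟩
  loopless := ⟨fun _ h => h.1 rfl⟩

lemma ripsGraph_mono {α β : ℝ} (h : α ≤ β) : ripsGraph D α ≤ ripsGraph D β :=
  fun _ _ hxy => ⟨hxy.1, hxy.2.trans h⟩

instance [HasBoundedGeometry D] (α : Set.Ioi (0 : ℝ)) (x : D) :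
    Finite ((ripsGraph D α).neighborSet x) := by
  obtain ⟨N, hN⟩ := HasBoundedGeometry.exists_encard_closedBall_le (D := D) α α.2
  refine (Set.finite_of_encard_le_coe (hN x)).subset fun y hy => ?_
  rw [Metric.mem_closedBall, dist_comm]
  exact hy.2

variable [HasBoundedGeometry D]

open Classical in
/-- The direct limit of the groups `H₀^BM(D(α))` over `α > 0`. -/
abbrev BMLimit : Type _ :=
  AddCommGroup.DirectLimit (fun α : Set.Ioi (0 : ℝ) => BMHomology0 (ripsGraph D α))
    fun _ _ h => bmMap (ripsGraph_mono D h)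

open Classical in
/-- The canonical map from `H₀^BM(D(α))` to the direct limit. -/
def toBMLimit (α : Set.Ioi (0 : ℝ)) : BMHomology0 (ripsGraph D α) →+ BMLimit D :=
  AddCommGroup.DirectLimit.of (fun α : Set.Ioi (0 : ℝ) => BMHomology0 (ripsGraph D α))
    (fun _ _ h => bmMap (ripsGraph_mono D h)) α

/-- The class of `c` in the direct limit can be computed at any `α`. -/
lemma toBMLimit_bmOnes (α β : Set.Ioi (0 : ℝ)) :
    toBMLimit D α (bmOnes (ripsGraph D α)) = toBMLimit D β (bmOnes (ripsGraph D β)) := by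
  classical
  have key : ∀ α β : Set.Ioi (0 : ℝ), α ≤ β →
      toBMLimit D α (bmOnes (ripsGraph D α)) = toBMLimit D β (bmOnes (ripsGraph D β)) :=
    fun α β h => (AddCommGroup.DirectLimit.of_f
      (G := fun α : Set.Ioi (0 : ℝ) => BMHomology0 (ripsGraph D α))
      (f := fun _ _ h => bmMap (ripsGraph_mono D h)) h (bmOnes (ripsGraph D α))).symm
  rcases le_total α β with h | h
  · exact key α β h
  · exact (key β α h).symm

end Rips

end CoarseK

end

/-!
Either some graph `D(β)` has no finite connected component, or for every `β` there is a nonempty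
finite set `C ⊆ D` at distance greater than `β` from its complement.

In the first case, the points of `D` can be pushed to infinity along edges of some `D(β)` so that
only finitely many orbits pass through each point. An Eilenberg swindle along the orbits kills both
classes: the edge from `x` to its successor, weighted by the number of visits to `x`, sums up to a
chain with boundary `c`, and shifting the orbits, realized by orthonormal vectors in `ℓ²(D) ⊗ H`,
gives a projection `q` with `i_D(1) ⊕ q ~ q`.

In the second case, a boundary of edges of length at most `β` sums to zero over `C`, while `c` sums
to the number of points of `C`. If `i_D(1)` had trivial class, there would be an isometry
`i_D(1) ⊕ 1 → 1` between multiples of the trivial module, with entries in the unitized Roe algebra.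
These entries almost commute with a projection `F` of finite rank supported in some `C`, so that
for a vector `x` in the ranges of `i_D(1)` and `F`, the isometry would map `ℂ x ⊕ (ran F)ᵏ` almost
isometrically to `(ran F)ᵏ`, which is impossible by a dimension count.
-/

noncomputable section

namespace CoarseK

/-! ### Escaping maps -/

section Escape

variable {V : Type*}

lemma finite_setOf_reflTransGen_of_acc {r : V → V → Prop} (hr : ∀ y, {x | r x y}.Finite) {y : V}
    (hy : Acc r y) : {x | Relation.ReflTransGen r x y}.Finite := by
  induction hy with
  | intro y _ ih =>
    refine ((Set.finite_singleton y).union ((hr y).biUnion fun z hz => ih z hz)).subset ?_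
    intro x hxy
    rcases hxy.cases_tail with rfl | ⟨z, hxz, hzy⟩
    · exact Or.inl rfl
    · exact Or.inr (Set.mem_biUnion hzy hxz)

/-- The orbits of `φ` escape to infinity, uniformly in that only finitely many of them pass
through each point. A pair `(x, k)` records a visit of the orbit of `x`, at time `k`. -/
def IsEscaping (φ : V → V) : Prop :=
  ∀ y, {p : V × ℕ | φ^[p.2] p.1 = y}.Finite

lemma IsEscaping.finite_fiber {φ : V → V} (hφ : IsEscaping φ) (y : V) : {x | φ x = y}.Finite :=
  (hφ y).preimage (f := fun x => (x, 1)) fun _ _ _ _ h => congrArg Prod.fst h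

lemma isEscaping_of_wellFounded {φ : V → V} (hfin : ∀ y, {x | φ x = y}.Finite)
    (hwf : WellFounded fun x y => φ x = y) : IsEscaping φ := by
  intro y
  induction y using hwf.induction with
  | h y ih =>
    refine ((Set.finite_singleton (y, 0)).union ((hfin y).biUnion fun z hz =>
      (ih z hz).image fun p : V × ℕ => (p.1, p.2 + 1))).subset ?_
    rintro ⟨x, _ | k⟩ hx
    · exact Or.inl (by simpa using hx)
    · refine Or.inr (Set.mem_biUnion (x := φ^[k] x) ?_ ⟨(x, k), rfl, rfl⟩)
      exact (Function.iterate_succ_apply' φ k x).symm.trans hx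

/-- Read `c x y` as "`x` is a child of `y`": a point from which no infinite line of descent starts
moves to a parent, any other point to a child on such a line. -/
lemma exists_wellFounded_map {c : V → V → Prop} (hc : WellFounded (flip c))
    (hparent : ∀ x, Acc c x → ∃ y, c x y) :
    ∃ φ : V → V, (∀ x, c x (φ x) ∨ c (φ x) x) ∧ WellFounded fun x y => φ x = y := by
  have hstep : ∀ x, ∃ y, (Acc c x → c x y) ∧ (¬ Acc c x → c y x ∧ ¬ Acc c y) := by
    intro x
    by_cases hx : Acc c x
    · obtain ⟨y, hy⟩ := hparent x hx
      exact ⟨y, fun _ => hy, fun h => absurd hx h⟩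
    · obtain ⟨y, hyx, hy⟩ : ∃ y, c y x ∧ ¬ Acc c y := by
        by_contra! h
        exact hx ⟨x, h⟩
      exact ⟨y, fun h => absurd h hx, fun _ => ⟨hyx, hy⟩⟩
  choose φ hup hdown using hstep
  have hacc : ∀ y, Acc c y → Acc (fun x y => φ x = y) y := by
    intro y hy
    induction hy with
    | intro y hy ih =>
      refine ⟨y, ?_⟩
      rintro x rfl
      by_cases hx : Acc c x
      · exact ih x (hup x hx)
      · exact absurd ⟨_, hy⟩ (hdown x hx).2
  refine ⟨φ, fun x => ?_, ⟨fun y => ?_⟩⟩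
  · by_cases hx : Acc c x
    · exact Or.inl (hup x hx)
    · exact Or.inr (hdown x hx).1
  · induction y using hc.induction with
    | h y ih =>
      refine ⟨y, ?_⟩
      rintro x rfl
      by_cases hx : Acc c x
      · exact hacc x hx
      · exact ih x (hdown x hx).1

variable (G : SimpleGraph V)

/-- The distance of `x` from a root chosen in its connected component. -/
def depth (x : V) : ℕ :=
  G.dist x (G.connectedComponentMk x).out

/-- `x` is adjacent to `y` and one step farther from the root of their component. -/
def IsChild (x y : V) : Prop :=
  G.Adj x y ∧ depth G x = depth G y + 1

variable {G}

lemma exists_adj_dist_eq_dist_add_one {x r : V} (h : G.dist x r ≠ 0) :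
    ∃ y, G.Adj x y ∧ G.dist x r = G.dist y r + 1 := by
  obtain ⟨p, hp⟩ := (SimpleGraph.Reachable.of_dist_ne_zero h).exists_walk_length_eq_dist
  cases p with
  | nil => exact absurd hp.symm h
  | @cons _ y _ hxy q =>
    have htri := hxy.reachable.dist_triangle_left r
    rw [SimpleGraph.dist_eq_one_iff_adj.2 hxy] at htri
    have hq := SimpleGraph.dist_le q
    rw [SimpleGraph.Walk.length_cons] at hp
    exact ⟨y, hxy, by lia⟩

lemma exists_isChild_of_depth_ne_zero {x : V} (hx : depth G x ≠ 0) : ∃ y, IsChild G x y := by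
  obtain ⟨y, hxy, hdist⟩ := exists_adj_dist_eq_dist_add_one hx
  refine ⟨y, hxy, hdist.trans ?_⟩
  rw [depth, SimpleGraph.ConnectedComponent.sound hxy.reachable]

lemma depth_eq_zero_iff {x : V} : depth G x = 0 ↔ x = (G.connectedComponentMk x).out :=
  (SimpleGraph.ConnectedComponent.exact (Quot.out_eq (G.connectedComponentMk x))).symm
    |>.dist_eq_zero_iff

lemma reflTransGen_isChild_root (x : V) :
    Relation.ReflTransGen (IsChild G) x (G.connectedComponentMk x).out := by
  induction hn : depth G x generalizing x with
  | zero =>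
    rw [← depth_eq_zero_iff.1 hn]
  | succ n ih =>
    obtain ⟨y, hxy⟩ := exists_isChild_of_depth_ne_zero (hn.trans_ne n.succ_ne_zero)
    rw [SimpleGraph.ConnectedComponent.sound hxy.1.reachable]
    exact .head hxy (ih y (Nat.succ_injective (hxy.2.symm.trans hn)))

theorem exists_isEscaping [∀ x, Finite (G.neighborSet x)]
    (hG : ∀ K : G.ConnectedComponent, K.supp.Infinite) :
    ∃ φ : V → V, (∀ x, G.Adj x (φ x)) ∧ IsEscaping φ := by
  have hwf : WellFounded (flip (IsChild G)) :=
    Subrelation.wf (fun h => Nat.lt_of_succ_le h.2.ge) (measure (depth G)).wf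
  have hparent : ∀ x, Acc (IsChild G) x → ∃ y, IsChild G x y := by
    intro x hx
    by_contra hroot
    have hxroot : x = (G.connectedComponentMk x).out :=
      depth_eq_zero_iff.1 <| by_contra fun h => hroot (exists_isChild_of_depth_ne_zero h)
    refine hG (G.connectedComponentMk x) ((finite_setOf_reflTransGen_of_acc (fun y =>
      (Set.toFinite (G.neighborSet y)).subset fun z hz => hz.1.symm) hx).subset fun y hy => ?_)
    have hyroot := reflTransGen_isChild_root (G := G) y
    rwa [show G.connectedComponentMk y = _ from hy, ← hxroot] at hyroot
  obtain ⟨φ, hφ, hφwf⟩ := exists_wellFounded_map hwf hparent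
  have hadj : ∀ x, G.Adj x (φ x) := fun x => (hφ x).elim And.left fun h => h.1.symm
  refine ⟨φ, hadj, isEscaping_of_wellFounded (fun y => ?_) hφwf⟩
  refine (Set.toFinite (G.neighborSet y)).subset ?_
  rintro x rfl
  exact (hadj x).symm

end Escape

/-! ### Boundaries of Borel–Moore chains -/

section Boundary

variable {V : Type*}

/-- The number of visits to `y` of all orbits of `φ` together; it is meaningful for escaping
maps and `0` where the number of visits is infinite. -/
def visitCount (φ : V → V) (y : V) : ℕ :=
  {p : V × ℕ | φ^[p.2] p.1 = y}.ncard

lemma IsEscaping.visitCount_eq {φ : V → V} (hφ : IsEscaping φ) (y : V) :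
    visitCount φ y = 1 + ∑ z ∈ (hφ.finite_fiber y).toFinset, visitCount φ z := by
  classical
  have hvisits : (hφ y).toFinset = insert (y, 0) ((hφ.finite_fiber y).toFinset.biUnion fun z =>
      (hφ z).toFinset.image (Prod.map id Nat.succ)) := by
    ext ⟨x, _ | k⟩
    · simp
    · simp [Function.iterate_succ_apply', -Function.iterate_succ]
  simp only [visitCount, Set.ncard_eq_toFinset_card _ (hφ _)]
  rw [hvisits, Finset.card_insert_of_notMem (by simp), add_comm, Finset.card_biUnion]
  · simp only [Finset.card_image_of_injective _
      (Function.injective_id.prodMap Nat.succ_injective)]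
  · intro z _ w _ hzw
    refine Finset.disjoint_left.2 ?_
    rintro ⟨x, k⟩ hz hw
    simp only [Finset.mem_image, Set.Finite.mem_toFinset, Set.mem_ofPred_eq, Prod.exists,
      Prod.map_apply, id_eq, Prod.mk.injEq] at hz hw
    obtain ⟨_, i, rfl, rfl, rfl⟩ := hz
    obtain ⟨_, j, rfl, rfl, hij⟩ := hw
    exact hzw (by rw [Nat.succ_injective hij])

variable (G : SimpleGraph V) [∀ x, Finite (G.neighborSet x)]

lemma bmBoundary_of_antisymm (a : V → V → ℤ) (ha : ∀ x y, a x y = -a y x) (y : V) :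
    bmBoundary G (fun e => a (e : Sym2 V).out.1 (e : Sym2 V).out.2) y =
      ∑ᶠ z ∈ G.neighborSet y, a z y := by
  classical
  change ∑ᶠ e : G.edgeSet, a (e : Sym2 V).out.1 (e : Sym2 V).out.2 * edgeBoundary (e : Sym2 V) y = _
  let ι : G.neighborSet y → G.edgeSet := fun z => ⟨s(y, z), z.2⟩
  have hι : Function.Injective ι := fun z w h =>
    Subtype.ext (Sym2.congr_right.1 (congrArg Subtype.val h))
  rw [← finsum_mem_univ, finsum_mem_inter_support_eq' (t := Set.range ι), finsum_mem_range hι,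
    ← finsum_set_coe_eq_finsum_mem]
  · refine finsum_congr fun z => ?_
    have hne : (z : V) ≠ y := (G.ne_of_adj z.2).symm
    have he : s((s(y, (z : V))).out.1, (s(y, (z : V))).out.2) = s(y, (z : V)) := Quot.out_eq _
    change a (s(y, (z : V))).out.1 (s(y, (z : V))).out.2 * edgeBoundary (s(y, (z : V))) y = _
    rw [edgeBoundary]
    rcases Sym2.eq_iff.1 he with ⟨h1, h2⟩ | ⟨h1, h2⟩
    · rw [h1, h2, if_neg hne, if_pos rfl, ha, zero_sub, neg_mul_neg, mul_one]
    · rw [h1, h2, if_neg hne, if_pos rfl, sub_zero, mul_one]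
  · intro e he
    refine ⟨fun _ => ?_, fun _ => trivial⟩
    obtain ⟨z, hz⟩ := mem_of_edgeBoundary_ne_zero (right_ne_zero_of_mul he)
    exact ⟨⟨z, by simpa [hz] using e.2⟩, Subtype.ext hz.symm⟩

/-- The edge from `x` to `φ x` carries one unit for each visit to `x`. -/
lemma one_mem_range_bmBoundary {φ : V → V} (hadj : ∀ x, G.Adj x (φ x)) (hφ : IsEscaping φ) :
    (1 : V → ℤ) ∈ (bmBoundary G).range := by
  classical
  let a : V → V → ℤ := fun x y =>
    (if φ y = x then (visitCount φ y : ℤ) else 0) - if φ x = y then (visitCount φ x : ℤ) else 0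
  refine ⟨_, funext fun y =>
    (bmBoundary_of_antisymm G a (fun x y => (neg_sub _ _).symm) y).trans ?_⟩
  have : Fintype (G.neighborSet y) := Fintype.ofFinite _
  have hfiber : ((G.neighborSet y).toFinset.filter fun z => φ z = y) =
      (hφ.finite_fiber y).toFinset := by
    ext z
    simp only [Finset.mem_filter, Set.mem_toFinset, SimpleGraph.mem_neighborSet,
      Set.Finite.mem_toFinset, Set.mem_ofPred_eq, and_iff_right_iff_imp]
    rintro rfl
    exact (hadj z).symm
  rw [finsum_mem_eq_toFinset_sum, Finset.sum_sub_distrib, Finset.sum_ite_eq,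
    if_pos (by simpa using hadj y), ← Finset.sum_filter, hfiber, hφ.visitCount_eq y]
  push_cast
  exact add_sub_cancel_right _ _

lemma sum_bmBoundary_eq_zero {C : Finset V} (hC : ∀ x ∈ C, ∀ y, G.Adj x y → y ∈ C)
    (b : BMChain1 G) : ∑ x ∈ C, bmBoundary G b x = 0 := by
  classical
  change ∑ x ∈ C, ∑ᶠ e : G.edgeSet, b e * edgeBoundary (e : Sym2 V) x = 0
  rw [← finsum_sum_comm _ _ fun x _ => finite_support_boundary G b x]
  refine (finsum_congr fun e => ?_).trans finsum_zero
  have he : G.Adj (e : Sym2 V).out.1 (e : Sym2 V).out.2 := by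
    have hout : s((e : Sym2 V).out.1, (e : Sym2 V).out.2) = e := Quot.out_eq _
    rw [← G.mem_edgeSet, hout]
    exact e.2
  have hiff : (e : Sym2 V).out.1 ∈ C ↔ (e : Sym2 V).out.2 ∈ C :=
    ⟨fun h => hC _ h _ he, fun h => hC _ h _ he.symm⟩
  simp only [← Finset.mul_sum, edgeBoundary, Finset.sum_sub_distrib, Finset.sum_ite_eq, hiff,
    sub_self, mul_zero]

end Boundary

/-! ### Isolated finite subsets -/

section Space

variable {D : Type*} [MetricSpace D]

/-- The points of `C` are at distance greater than `R` from the complement of `C`. -/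
def IsIsolated (R : ℝ) (C : Finset D) : Prop :=
  ∀ x ∈ C, ∀ y ∉ C, R < dist x y

lemma IsIsolated.mono {R S : ℝ} {C : Finset D} (h : R ≤ S) (hC : IsIsolated S C) :
    IsIsolated R C :=
  fun x hx y hy => h.trans_lt (hC x hx y hy)

lemma IsIsolated.mem_of_ripsGraph_adj {R : ℝ} {C : Finset D} (hC : IsIsolated R C) {x y : D}
    (hx : x ∈ C) (hxy : (ripsGraph D R).Adj x y) : y ∈ C := by
  by_contra hy
  exact (hC x hx y hy).not_ge hxy.2

variable (D)

/-- The points of `D` can be moved to infinity by steps of bounded length. -/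
def PointsEscape : Prop :=
  ∃ β : Set.Ioi (0 : ℝ), ∃ φ : D → D, (∀ x, (ripsGraph D β).Adj x (φ x)) ∧ IsEscaping φ

/-- `D` has nonempty finite subsets that are arbitrarily far from their complements. -/
def HasIsolatedFinsets : Prop :=
  ∀ β : Set.Ioi (0 : ℝ), ∃ C : Finset D, C.Nonempty ∧ IsIsolated β C

variable [HasBoundedGeometry D]

lemma pointsEscape_or_hasIsolatedFinsets : PointsEscape D ∨ HasIsolatedFinsets D := by
  refine or_iff_not_imp_right.2 fun h => ?_
  simp only [HasIsolatedFinsets, not_forall, not_exists, not_and] at h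
  obtain ⟨β, hβ⟩ := h
  refine ⟨β, exists_isEscaping fun K hK => ?_⟩
  refine hβ hK.toFinset (hK.toFinset_nonempty.2 K.nonempty_supp) fun x hx y hy => ?_
  rw [Set.Finite.mem_toFinset] at hx hy
  by_contra! hxy
  exact hy (K.mem_supp_of_adj_mem_supp hx ⟨ne_of_mem_of_not_mem hx hy, hxy⟩)

lemma toBMLimit_bmOnes_eq_zero_iff (α : Set.Ioi (0 : ℝ)) :
    toBMLimit D α (bmOnes (ripsGraph D α)) = 0 ↔
      ∃ β : Set.Ioi (0 : ℝ), (1 : D → ℤ) ∈ (bmBoundary (ripsGraph D β)).range := by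
  classical
  constructor
  · intro h
    have : DirectedSystem (fun α : Set.Ioi (0 : ℝ) => BMHomology0 (ripsGraph D α))
        fun _ _ h => bmMap (ripsGraph_mono D h) :=
      ⟨fun i x => by obtain ⟨x, rfl⟩ := QuotientAddGroup.mk_surjective x; rfl,
        fun i j k _ _ x => by obtain ⟨x, rfl⟩ := QuotientAddGroup.mk_surjective x; rfl⟩
    obtain ⟨β, _, hβ⟩ := AddCommGroup.DirectLimit.of.zero_exact _ _ h
    exact ⟨β, (QuotientAddGroup.eq_zero_iff _).1 hβ⟩
  · rintro ⟨β, hβ⟩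
    rw [toBMLimit_bmOnes D α β, bmOnes, (QuotientAddGroup.eq_zero_iff _).2 hβ, map_zero]

variable {D}

lemma PointsEscape.toBMLimit_bmOnes_eq_zero (h : PointsEscape D) (α : Set.Ioi (0 : ℝ)) :
    toBMLimit D α (bmOnes (ripsGraph D α)) = 0 := by
  obtain ⟨β, φ, hadj, hφ⟩ := h
  exact (toBMLimit_bmOnes_eq_zero_iff D α).2 ⟨β, one_mem_range_bmBoundary _ hadj hφ⟩

lemma HasIsolatedFinsets.toBMLimit_bmOnes_ne_zero (h : HasIsolatedFinsets D)
    (α : Set.Ioi (0 : ℝ)) : toBMLimit D α (bmOnes (ripsGraph D α)) ≠ 0 := by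
  rw [ne_eq, toBMLimit_bmOnes_eq_zero_iff]
  rintro ⟨β, b, hb⟩
  obtain ⟨C, hne, hC⟩ := h β
  have hsum := sum_bmBoundary_eq_zero (ripsGraph D β)
    (fun _ hx _ hxy => hC.mem_of_ripsGraph_adj hx hxy) b
  rw [hb] at hsum
  exact hne.card_ne_zero (by simpa using hsum)

end Space

/-! ### Vanishing of classes in `K₀` -/

section Vanishing

open Matrix

section Swindle

variable {R S F : Type*} [NonUnitalRing R] [StarRing R] [NonUnitalRing S] [StarRing S]
  [FunLike F R S] [NonUnitalRingHomClass F R S] [StarHomClass F R S]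

/-- The projection `q` absorbs the projection `p`: the partial isometries `v` and `w` identify
`p` and `q` with orthogonal projections of sum `q`. -/
structure IsSwindle (p q v w : R) : Prop where
  isStarProjection : IsStarProjection q
  star_mul_left : star v * v = p
  star_mul_right : star w * w = q
  orthogonal : star v * w = 0
  add_eq : v * star v + w * star w = q

lemma isSwindle_map_iff {φ : F} (hφ : Function.Injective φ) {p q v w : R} :
    IsSwindle (φ p) (φ q) (φ v) (φ w) ↔ IsSwindle p q v w := by
  constructor
  · rintro ⟨⟨hidem, hself⟩, hv, hw, hvw, hadd⟩
    refine ⟨⟨hφ ?_, hφ ?_⟩, hφ ?_, hφ ?_, hφ ?_, hφ ?_⟩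
    · simpa only [map_mul] using hidem.eq
    · simpa only [map_star] using hself.star_eq
    all_goals simpa only [map_mul, map_star, map_add, map_zero]
  · rintro ⟨hq, rfl, hw, hvw, hadd⟩
    exact ⟨hq.map φ, by rw [map_mul, map_star], by rw [← map_star, ← map_mul, hw],
      by rw [← map_star, ← map_mul, hvw, map_zero],
      by rw [← map_star, ← map_star, ← map_mul, ← map_mul, ← map_add, hadd]⟩

lemma IsSwindle.mvN {R : Type*} [Ring R] [StarRing R] {p q v w : R} (h : IsSwindle p q v w) :
    MvN (fromBlocks (of fun _ _ : Fin 1 => p) 0 0 (of fun _ _ : Fin 1 => q))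
      (of fun _ _ : Fin 1 => q) := by
  have hwv : star w * v = 0 := by simpa using congrArg star h.orthogonal
  refine ⟨fromCols (of fun _ _ => v) (of fun _ _ => w), ?_, ?_⟩
  · ext (i | i) (j | j) <;>
      simp [mul_apply, h.star_mul_left, h.star_mul_right, h.orthogonal, hwv]
  · ext i j
    simp [mul_apply, h.add_eq]

end Swindle

lemma K00.mk_eq_zero_iff {R : Type*} [Ring R] [StarRing R] (p : MatProj R) :
    K00.mk p = 0 ↔ ∃ q : MatProj R, MvN (fromBlocks p.mat 0 0 q.mat) q.mat := by
  have habsorb : ∀ q : MatProj R, ProjMonoid.mk p + ProjMonoid.mk q = ProjMonoid.mk q ↔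
      MvN (fromBlocks p.mat 0 0 q.mat) q.mat := fun q => by
    rw [ProjMonoid.mk_add_mk, ProjMonoid.mk_eq_mk]
    exact ⟨(p.add_mat q).trans (isStarProjection_fromBlocks p.isProj q.isProj) q.isProj,
      (p.add_mat q).symm.trans (p.add q).isProj q.isProj⟩
  constructor
  · intro h
    rw [← map_zero (Algebra.GrothendieckAddGroup.of (M := ProjMonoid R))] at h
    obtain ⟨⟨⟨q⟩, _⟩, hq⟩ := (AddLocalization.addMonoidOf ⊤).eq_iff_exists.1 h
    refine ⟨q, (habsorb q).1 ?_⟩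
    rw [add_comm]
    exact hq.trans (add_zero _)
  · rintro ⟨q, hq⟩
    have h := congrArg Algebra.GrothendieckAddGroup.of ((habsorb q).2 hq)
    rw [map_add] at h
    exact add_eq_right.1 h

variable {A : Type*} [NonUnitalRing A] [StarRing A] [Module ℂ A] [IsScalarTower ℂ A A]
  [SMulCommClass ℂ A A] [StarModule ℂ A]

lemma K0.ofProj_eq_zero_iff {p : A} (hp : IsStarProjection p) :
    K0.ofProj hp = 0 ↔ ∃ q : MatProj (Unitization ℂ A),
      MvN (fromBlocks (projMat hp).mat 0 0 q.mat) q.mat :=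
  Subtype.ext_iff.trans (K00.mk_eq_zero_iff _)

lemma IsSwindle.ofProj_eq_zero {p q v w : A} (h : IsSwindle p q v w) (hp : IsStarProjection p) :
    K0.ofProj hp = 0 :=
  (K0.ofProj_eq_zero_iff hp).2 ⟨projMat h.isStarProjection,
    ((isSwindle_map_iff (φ := Unitization.inrNonUnitalStarAlgHom ℂ A)
      Unitization.inr_injective).2 h).mvN⟩

lemma K0.ofProj_eq_zero_of_exists_isSwindle {R : Type*} [Ring R] [StarRing R] [Algebra ℂ R]
    [StarModule ℂ R] {S : NonUnitalStarSubalgebra ℂ R} {p : S} (hp : IsStarProjection p)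
    (h : ∃ q ∈ S, ∃ v ∈ S, ∃ w ∈ S, IsSwindle (p : R) q v w) : K0.ofProj hp = 0 := by
  obtain ⟨q, hq, v, hv, w, hw, h⟩ := h
  have hS : IsSwindle p (⟨q, hq⟩ : S) ⟨v, hv⟩ ⟨w, hw⟩ :=
    (isSwindle_map_iff (φ := NonUnitalStarSubalgebraClass.subtype S) Subtype.val_injective).1 h
  exact hS.ofProj_eq_zero hp

lemma K0.map_ofProj {B : Type*} [NonUnitalRing B] [StarRing B] [Module ℂ B] [IsScalarTower ℂ B B]
    [SMulCommClass ℂ B B] [StarModule ℂ B] (φ : A →⋆ₙₐ[ℂ] B) {p : A} (hp : IsStarProjection p)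
    (hφp : IsStarProjection (φ p)) : K0.map φ (K0.ofProj hp) = K0.ofProj hφp := by
  refine Subtype.ext ?_
  change K00.map (Unitization.starMap φ) (K00.mk (projMat hp)) = K00.mk (projMat hφp)
  rw [K00.map_mk]
  congr 1
  unfold MatProj.map projMat
  congr 1
  exact Matrix.ext fun _ _ => Unitization.starMap_inr φ p

end Vanishing

/-! ### Operators on `ℓ²` -/

section Orthonormal

open scoped InnerProduct

variable {I E F : Type*} [NormedAddCommGroup E] [NormedSpace ℂ E]
  [NormedAddCommGroup F] [InnerProductSpace ℂ F] [CompleteSpace F]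

lemma clm_ext_single [DecidableEq I] {A B : L2 I ℂ →L[ℂ] E}
    (h : ∀ i, A (lp.single 2 i 1) = B (lp.single 2 i 1)) : A = B :=
  lp.ext_continuousLinearMap ENNReal.ofNat_ne_top fun i => ContinuousLinearMap.ext_ring (h i)

lemma adjoint_apply_coord [DecidableEq I] (B : L2 I ℂ →L[ℂ] F) (v : F) (i : I) :
    (B†) v i = inner ℂ (B (lp.single 2 i 1)) v := by
  simp [← ContinuousLinearMap.adjoint_inner_right, lp.inner_single_left]

lemma hasSum_apply_adjoint [DecidableEq I] (A : L2 I ℂ →L[ℂ] E) (B : L2 I ℂ →L[ℂ] F) (v : F) :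
    HasSum (fun i => inner ℂ (B (lp.single 2 i 1)) v • A (lp.single 2 i 1)) (A ((B†) v)) := by
  have hcoord (i : I) : A (lp.single 2 i ((B†) v i)) =
      inner ℂ (B (lp.single 2 i 1)) v • A (lp.single 2 i 1) := by
    rw [← adjoint_apply_coord, ← map_smul, ← lp.single_smul, smul_eq_mul, mul_one]
  simpa only [hcoord] using (lp.hasSum_single ENNReal.ofNat_ne_top ((B†) v)).mapL A

/-- The operator `ℓ²(I) → F` that maps the standard basis to an orthonormal family. -/
def orthonormalMap {w : I → F} (hw : Orthonormal ℂ w) : L2 I ℂ →L[ℂ] F :=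
  hw.orthogonalFamily.linearIsometry.toContinuousLinearMap

lemma orthonormalMap_single [DecidableEq I] {w : I → F} (hw : Orthonormal ℂ w) (i : I) :
    orthonormalMap hw (lp.single 2 i 1) = w i :=
  (hw.orthogonalFamily.linearIsometry_apply_single 1).trans (one_smul ℂ (w i))

lemma adjoint_orthonormalMap_comp_self {w : I → F} (hw : Orthonormal ℂ w) :
    (orthonormalMap hw)† ∘L orthonormalMap hw = 1 :=
  LinearIsometry.adjoint_comp_self _

lemma adjoint_orthonormalMap_comp_eq_zero {J : Type*} {w : I → F} {w' : J → F}
    (hw : Orthonormal ℂ w) (hw' : Orthonormal ℂ w') (h : ∀ i j, inner ℂ (w i) (w' j) = 0) :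
    (orthonormalMap hw)† ∘L orthonormalMap hw' = 0 := by
  classical
  refine clm_ext_single fun j => lp.ext <| funext fun i => ?_
  rw [ContinuousLinearMap.comp_apply, adjoint_apply_coord, orthonormalMap_single,
    orthonormalMap_single, h]
  rfl

lemma hasSum_orthonormalMap_adjoint {w : I → F} (hw : Orthonormal ℂ w) (v : F) :
    HasSum (fun i => inner ℂ (w i) v • w i) (orthonormalMap hw (((orthonormalMap hw)†) v)) := by
  classical
  simpa only [orthonormalMap_single] using
    hasSum_apply_adjoint (orthonormalMap hw) (orthonormalMap hw) v

lemma orthonormalMap_comp_adjoint_add {J K : Type*} {w : I → F} (e : J ⊕ K ≃ I)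
    (hw : Orthonormal ℂ w) (hJ : Orthonormal ℂ fun j => w (e (Sum.inl j)))
    (hK : Orthonormal ℂ fun k => w (e (Sum.inr k))) :
    orthonormalMap hJ ∘L (orthonormalMap hJ)† + orthonormalMap hK ∘L (orthonormalMap hK)† =
      orthonormalMap hw ∘L (orthonormalMap hw)† := by
  ext v
  have hsum : HasSum ((fun i => inner ℂ (w i) v • w i) ∘ e) _ :=
    HasSum.sum (hasSum_orthonormalMap_adjoint hJ v) (hasSum_orthonormalMap_adjoint hK v)
  exact hsum.unique (e.hasSum_iff.2 (hasSum_orthonormalMap_adjoint hw v))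

lemma exists_orthonormal_nat (hF : ¬ FiniteDimensional ℂ F) : ∃ e : ℕ → F, Orthonormal ℂ e := by
  obtain ⟨s, b, -⟩ := exists_hilbertBasis ℂ F
  have : Infinite s := by
    by_contra hs
    rw [not_infinite_iff_finite] at hs
    have := Fintype.ofFinite s
    exact hF b.toOrthonormalBasis.toBasis.finiteDimensional_of_finite
  exact ⟨_, b.orthonormal.comp (Infinite.natEmbedding s) (Infinite.natEmbedding s).injective⟩

lemma isSwindle_of_isometries {M N : Type*} [NormedAddCommGroup M] [InnerProductSpace ℂ M]
    [CompleteSpace M] [NormedAddCommGroup N] [InnerProductSpace ℂ N] [CompleteSpace N]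
    {P W₀ : M →L[ℂ] F} {W W₁ : N →L[ℂ] F} (hP : P† ∘L P = 1) (hW : W† ∘L W = 1)
    (hW₀ : W₀† ∘L W₀ = 1) (hW₁ : W₁† ∘L W₁ = 1) (hortho : W₀† ∘L W₁ = 0)
    (hadd : W₀ ∘L W₀† + W₁ ∘L W₁† = W ∘L W†) :
    IsSwindle (P ∘L P†) (W ∘L W†) (W₀ ∘L P†) (W₁ ∘L W†) := by
  rw [ContinuousLinearMap.ext_iff] at hP hW hW₀ hW₁ hortho
  refine ⟨⟨?_, ?_⟩, ?_, ?_, ?_, ?_⟩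
  · ext u
    exact congrArg W (hW _)
  · rw [IsSelfAdjoint, ContinuousLinearMap.star_eq_adjoint, ContinuousLinearMap.adjoint_comp,
      ContinuousLinearMap.adjoint_adjoint]
  all_goals
    simp only [ContinuousLinearMap.star_eq_adjoint, ContinuousLinearMap.adjoint_comp,
      ContinuousLinearMap.adjoint_adjoint]
  · ext u
    exact congrArg P (hW₀ _)
  · ext u
    exact congrArg W (hW₁ _)
  · ext u
    exact (congrArg P (hortho _)).trans (map_zero P)
  · rw [← hadd]
    ext u
    exact congrArg₂ (· + ·) (congrArg W₀ (hP _)) (congrArg W₁ (hW _))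

end Orthonormal

/-! ### Elements of the Roe algebra -/

section Elements

open Filter Topology
open scoped InnerProduct

variable {D I H : Type*} [MetricSpace D] [NormedAddCommGroup H] [InnerProductSpace ℂ H]

lemma isCompactOperator_of_finite_support {E : Type*} [NormedAddCommGroup E] [NormedSpace ℂ E]
    [DecidableEq I] {T : L2 I ℂ →L[ℂ] E} (hT : {i | T (lp.single 2 i 1) ≠ 0}.Finite) :
    IsCompactOperator T := by
  let column (i : I) : L2 I ℂ →L[ℂ] E :=
    (T ∘L lp.singleContinuousLinearMap ℂ (fun _ : I => ℂ) 2 i) ∘L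
      lp.evalCLM ℂ (fun _ : I => ℂ) 2 i
  have hcolumn (i j : I) : column j (lp.single 2 i 1) =
      if j = i then T (lp.single 2 i 1) else 0 := by
    change T (lp.single 2 j ((lp.single 2 i 1 : L2 I ℂ) j)) = _
    split_ifs with hj
    · rw [hj, lp.single_apply_self]
    · rw [lp.single_apply_ne _ _ _ hj, lp.single_zero, map_zero]
  have hsum : T = ∑ j ∈ hT.toFinset, column j := by
    refine clm_ext_single fun i => ?_
    simp only [sum_apply, hcolumn, Finset.sum_ite_eq']
    split_ifs with hi
    · rfl
    · exact not_not.1 (hT.mem_toFinset.not.1 hi)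
  rw [hsum]
  exact Submodule.sum_mem (compactOperator (RingHom.id ℂ) (L2 I ℂ) E) fun i _ =>
    IsCompactOperator.comp_clm (isCompactOperator_of_locallyCompactSpace_rng
      (T ∘L lp.singleContinuousLinearMap ℂ (fun _ : I => ℂ) 2 i)) _

lemma tendsto_restrictFinset [DiscreteTopology D] (f : C₀(D, ℂ)) :
    Tendsto (fun F : Finset D => restrictFinset f F) atTop (𝓝 f) := by
  refine Metric.tendsto_nhds.2 fun ε hε => ?_
  have hfin : {x | ε / 2 ≤ ‖f x‖}.Finite := by
    have hlim : Tendsto (fun x => ‖f x‖) cofinite (𝓝 0) := by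
      rw [← cocompact_eq_cofinite, ← norm_zero (E := ℂ)]
      exact f.zero_at_infty'.norm
    simpa using hlim.eventually (gt_mem_nhds (half_pos hε))
  filter_upwards [eventually_ge_atTop hfin.toFinset] with F hF
  refine lt_of_le_of_lt ?_ (half_lt_self hε)
  rw [dist_eq_norm, ← ZeroAtInftyContinuousMap.norm_toBCF_eq_norm,
    BoundedContinuousFunction.norm_le (half_pos hε).le]
  intro x
  change ‖(F : Set D).indicator f x - f x‖ ≤ ε / 2
  by_cases hx : x ∈ F
  · rw [Set.indicator_of_mem (Finset.mem_coe.2 hx), sub_self, norm_zero]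
    exact (half_pos hε).le
  · rw [Set.indicator_of_notMem (Finset.mem_coe.not.2 hx), zero_sub, norm_neg]
    exact (not_le.1 fun h => hx (hF (hfin.mem_toFinset.2 h))).le

variable [CompleteSpace H]

lemma mulRep_single [DecidableEq D] (f : C₀(D, ℂ)) (x : D) (h : H) :
    mulRep D H f (lp.single 2 x h) = f x • (lp.single 2 x h : L2 D H) := by
  ext y
  rw [mulRep_apply, lp.coeFn_smul, Pi.smul_apply]
  obtain rfl | hy := eq_or_ne y x
  · rfl
  · rw [lp.single_apply_ne _ _ _ hy, smul_zero, smul_zero]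

variable [DecidableEq D] [DecidableEq I] {A B : L2 I ℂ →L[ℂ] L2 D H} {a b : I → D} {h k : I → H}

lemma isCompactOperator_mulRep_comp [DiscreteTopology D]
    (hA : ∀ i, A (lp.single 2 i 1) = lp.single 2 (a i) (h i)) (ha : ∀ y, {i | a i = y}.Finite)
    (f : C₀(D, ℂ)) : IsCompactOperator (mulRep D H f ∘L A) := by
  have hcont : Continuous (mulRep D H) := AddMonoidHomClass.continuous_of_bound (mulRep D H) 1
    fun f => (norm_rep_le _ f).trans_eq (one_mul _).symm
  have hlim : Tendsto (fun F : Finset D => mulRep D H (restrictFinset f F) ∘L A) atTop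
      (𝓝 (mulRep D H f ∘L A)) :=
    ((hcont.clm_comp continuous_const).tendsto f).comp (tendsto_restrictFinset f)
  refine isCompactOperator_of_tendsto hlim (Eventually.of_forall fun F => ?_)
  refine isCompactOperator_of_finite_support ((F.finite_toSet.biUnion fun y _ => ha y).subset ?_)
  intro i hi
  refine Set.mem_biUnion (x := a i) ?_ rfl
  by_contra hF
  apply hi
  rw [ContinuousLinearMap.comp_apply, hA, mulRep_single,
    show restrictFinset f F (a i) = 0 from Set.indicator_of_notMem hF f, zero_smul]

lemma mulRep_comp_adjoint_mulRep_eq_zero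
    (hA : ∀ i, A (lp.single 2 i 1) = lp.single 2 (a i) (h i))
    (hB : ∀ i, B (lp.single 2 i 1) = lp.single 2 (b i) (k i)) {f g : C₀(D, ℂ)}
    (hfg : ∀ i, f (a i) = 0 ∨ g (b i) = 0) :
    mulRep D H f * (A ∘L B†) * mulRep D H g = 0 := by
  have hadj : B† ∘L mulRep D H g = (mulRep D H (star g) ∘L B)† := by
    rw [ContinuousLinearMap.adjoint_comp, ← ContinuousLinearMap.star_eq_adjoint (mulRep D H _),
      ← map_star, star_star]
  change (mulRep D H f ∘L A) ∘L B† ∘L mulRep D H g = 0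
  rw [hadj]
  ext1 v
  rw [zero_apply]
  refine (hasSum_apply_adjoint (mulRep D H f ∘L A) (mulRep D H (star g) ∘L B) v).unique ?_
  convert hasSum_zero using 2 with i
  rcases hfg i with hi | hi <;> simp [hA, hB, mulRep_single, hi]

lemma comp_adjoint_mem_roeAlg [DiscreteTopology D]
    (hA : ∀ i, A (lp.single 2 i 1) = lp.single 2 (a i) (h i)) (ha : ∀ y, {i | a i = y}.Finite)
    (hB : ∀ i, B (lp.single 2 i 1) = lp.single 2 (b i) (k i)) (hb : ∀ y, {i | b i = y}.Finite)
    {R : ℝ} (hR : 0 < R) (hab : ∀ i, dist (a i) (b i) ≤ R) :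
    A ∘L B† ∈ RoeAlg D H := by
  refine NonUnitalStarSubalgebra.le_topologicalClosure _
    ⟨fun f => ⟨?_, ?_⟩, R, hR, fun f g hfg => ?_⟩
  · have hcompact : IsCompactOperator (mulRep D H (star f) * (B ∘L A†)) :=
      (isCompactOperator_mulRep_comp hB hb (star f)).comp_clm (A†)
    simpa only [star_mul, ← map_star, star_star, ContinuousLinearMap.star_eq_adjoint (B ∘L _),
      ContinuousLinearMap.adjoint_comp, ContinuousLinearMap.adjoint_adjoint] using
      isCompactOperator_adjoint hcompact
  · exact (isCompactOperator_mulRep_comp hA ha f).comp_clm (B†)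
  · refine mulRep_comp_adjoint_mulRep_eq_zero (I := I) hA hB fun i => ?_
    by_contra! hne
    exact (hab i).not_gt (lt_dist_of_ofReal_lt_setDist hfg (subset_tsupport f hne.1)
      (subset_tsupport g hne.2))

end Elements

section Orbits

variable {D I H : Type*} [NormedAddCommGroup H] [InnerProductSpace ℂ H] [DecidableEq D]

lemma isoD_single (V : ℂ →ₗᵢ[ℂ] H) (x : D) :
    isoD D V (lp.single 2 x 1) = lp.single 2 x (V 1) := by
  ext y
  change V ((lp.single 2 x 1 : L2 D ℂ) y) = _
  obtain rfl | hy := eq_or_ne y x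
  · rw [lp.single_apply_self, lp.single_apply_self]
  · rw [lp.single_apply_ne _ _ _ hy, lp.single_apply_ne _ _ _ hy, map_zero]

lemma orthonormal_lp_single {N : Type*} {e : N → H} (he : Orthonormal ℂ e) :
    Orthonormal ℂ fun p : D × N => (lp.single 2 p.1 (e p.2) : L2 D H) := by
  refine ⟨fun p => (lp.norm_single (by norm_num) _ _).trans (he.1 p.2), ?_⟩
  rintro ⟨x, m⟩ ⟨y, n⟩ hne
  rw [lp.inner_single_left]
  obtain rfl | hxy := eq_or_ne x y
  · rw [lp.single_apply_self]
    exact he.2 fun hmn => hne (congrArg (Prod.mk x) hmn)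
  · rw [lp.single_apply_ne _ _ _ hxy, inner_zero_right]

lemma exists_orthonormal_single [CompleteSpace H] (hH : ¬ FiniteDimensional ℂ H) {l : I → D}
    (hl : ∀ y, {i | l i = y}.Countable) :
    ∃ h : I → H, Orthonormal ℂ fun i => (lp.single 2 (l i) (h i) : L2 D H) := by
  obtain ⟨e, he⟩ := exists_orthonormal_nat hH
  choose n hn using fun y => Set.countable_iff_exists_injOn.1 (hl y)
  refine ⟨fun i => e (n (l i) i), (orthonormal_lp_single he).comp (fun i => (l i, n (l i) i)) ?_⟩
  intro i j hij
  obtain ⟨hlij, hnij⟩ := Prod.mk.inj hij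
  exact hn (l j) hlij rfl (hlij ▸ hnij)

/-- The decomposition of a family of sequences into the initial terms and the shifted sequences. -/
def shiftEquiv (D : Type*) : D ⊕ D × ℕ ≃ D × ℕ where
  toFun := Sum.elim (fun x => (x, 0)) fun p => (p.1, p.2 + 1)
  invFun p := match p with
    | (x, 0) => Sum.inl x
    | (x, k + 1) => Sum.inr (x, k)
  left_inv := by rintro (x | ⟨x, k⟩) <;> rfl
  right_inv := by rintro ⟨x, _ | k⟩ <;> rfl

end Orbits

section Vanishing

open scoped InnerProduct

variable {D H : Type*} [MetricSpace D] [DiscreteTopology D] [NormedAddCommGroup H]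
  [InnerProductSpace ℂ H] [CompleteSpace H]

/-- The orbits `(φ^[k] x)ₖ` are realized as orthonormal sequences of vectors over their points;
`q` is the projection onto their span, `v` starts each orbit and `w` moves it by one step. -/
lemma PointsEscape.exists_isSwindle (hD : PointsEscape D) (hH : ¬ FiniteDimensional ℂ H)
    (V : ℂ →ₗᵢ[ℂ] H) : ∃ q ∈ RoeAlg D H, ∃ v ∈ RoeAlg D H, ∃ w ∈ RoeAlg D H,
      IsSwindle (iD D V (uniformRoeOne D) : L2 D H →L[ℂ] L2 D H) q v w := by
  classical
  obtain ⟨⟨β, hβ⟩, φ, hφ, hesc⟩ := hD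
  let label (p : D × ℕ) : D := φ^[p.2] p.1
  obtain ⟨h, hw⟩ : ∃ h : D × ℕ → H,
      Orthonormal ℂ fun p => (lp.single 2 (label p) (h p) : L2 D H) :=
    exists_orthonormal_single hH fun y => (hesc y).countable
  have hinj := (shiftEquiv D).injective
  have hstart := hw.comp (fun x => shiftEquiv D (Sum.inl x)) (hinj.comp Sum.inl_injective)
  have hshift := hw.comp (fun p => shiftEquiv D (Sum.inr p)) (hinj.comp Sum.inr_injective)
  have hfin_shift (y : D) : {p | label (shiftEquiv D (Sum.inr p)) = y}.Finite :=
    (hesc y).preimage (hinj.comp Sum.inr_injective).injOn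
  have hid (y : D) : {x | x = y}.Finite := Set.finite_singleton y
  have hq := comp_adjoint_mem_roeAlg (orthonormalMap_single hw) hesc (orthonormalMap_single hw)
    hesc hβ fun p => (dist_self (label p)).trans_le hβ.le
  have hv := comp_adjoint_mem_roeAlg (B := (isoD D V).toContinuousLinearMap)
    (orthonormalMap_single hstart) hid (isoD_single V) hid hβ fun x => (dist_self x).trans_le hβ.le
  have hw' := comp_adjoint_mem_roeAlg (orthonormalMap_single hshift) hfin_shift
    (orthonormalMap_single hw) hesc hβ fun p => by
      change dist (φ^[p.2 + 1] p.1) (φ^[p.2] p.1) ≤ β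
      rw [Function.iterate_succ_apply', dist_comm]
      exact (hφ _).2
  refine ⟨_, hq, _, hv, _, hw', isSwindle_of_isometries (P := (isoD D V).toContinuousLinearMap)
    (isoD D V).adjoint_comp_self (adjoint_orthonormalMap_comp_self hw)
    (adjoint_orthonormalMap_comp_self hstart) (adjoint_orthonormalMap_comp_self hshift)
    (adjoint_orthonormalMap_comp_eq_zero hstart hshift fun x p => hw.2 ?_)
    (orthonormalMap_comp_adjoint_add (shiftEquiv D) hw hstart hshift)⟩
  exact hinj.ne Sum.inl_ne_inr

variable (D) in
lemma isStarProjection_iD_one (V : ℂ →ₗᵢ[ℂ] H) : IsStarProjection (iD D V (uniformRoeOne D)) :=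
  (isStarProjection_uniformRoeOne D).map (iD D V)

lemma iD_unitClass (V : ℂ →ₗᵢ[ℂ] H) :
    K0.map (iD D V) (unitClass D) = K0.ofProj (isStarProjection_iD_one D V) :=
  K0.map_ofProj _ _ _

lemma PointsEscape.iD_unitClass_eq_zero (hD : PointsEscape D) (hH : ¬ FiniteDimensional ℂ H)
    (V : ℂ →ₗᵢ[ℂ] H) : K0.map (iD D V) (unitClass D) = 0 :=
  (iD_unitClass V).trans (K0.ofProj_eq_zero_of_exists_isSwindle (isStarProjection_iD_one D V)
    (hD.exists_isSwindle hH V))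

end Vanishing

/-! ### Matrices of operators -/

section Isometry

open Matrix

lemma MvN.exists_partialIsometry {R : Type*} [Ring R] [StarRing R] {m n : Type*} [Fintype m]
    [Fintype n] {p : Matrix m m R} {q : Matrix n n R} (hp : IsStarProjection p) (h : MvN p q) :
    ∃ w : Matrix n m R, wᴴ * w = p ∧ q * w = w := by
  obtain ⟨v, rfl, rfl⟩ := h
  have hidem : vᴴ * v * (vᴴ * v) = vᴴ * v := hp.isIdempotentElem
  refine ⟨v * (vᴴ * v), ?_, ?_⟩
  · rw [conjTranspose_mul, conjTranspose_mul, conjTranspose_conjTranspose, Matrix.mul_assoc,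
      ← Matrix.mul_assoc vᴴ v (vᴴ * v), hidem, hidem]
  · rw [← Matrix.mul_assoc, Matrix.mul_assoc v, Matrix.mul_assoc v, hidem]

/-- The partial isometry `p ⊕ q → q` is completed by the identity of `1 - q`. -/
lemma exists_isometry_of_mvN {R : Type*} [Ring R] [StarRing R] {m n : Type*} [Fintype m] [Fintype n]
    [DecidableEq n] {p : Matrix m m R} {q : Matrix n n R} (hp : IsStarProjection p)
    (hq : IsStarProjection q) (h : MvN (fromBlocks p 0 0 q) q) :
    ∃ Z : Matrix n (m ⊕ n) R, Zᴴ * Z = fromBlocks p 0 0 1 := by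
  obtain ⟨w, hw, hqw⟩ := h.exists_partialIsometry (isStarProjection_fromBlocks hp hq)
  have hstar : (1 - q)ᴴ = 1 - q := hq.one_sub.isSelfAdjoint
  have hidem : (1 - q) * (1 - q) = 1 - q := hq.one_sub.isIdempotentElem
  let J : Matrix n (m ⊕ n) R := fromCols 0 (1 - q)
  have hJw : Jᴴ * w = 0 := by
    rw [conjTranspose_fromCols_eq_fromRows_conjTranspose, hstar, fromRows_mul, Matrix.sub_mul, hqw]
    simp
  have hwJ : wᴴ * J = 0 := by simpa using congrArg conjTranspose hJw
  have hJJ : Jᴴ * J = fromBlocks 0 0 0 (1 - q) := by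
    rw [conjTranspose_fromCols_eq_fromRows_conjTranspose, hstar, fromRows_mul_fromCols, hidem]
    simp
  refine ⟨w + J, ?_⟩
  rw [conjTranspose_add, Matrix.add_mul, Matrix.mul_add, Matrix.mul_add, hw, hwJ, hJw, hJJ,
    add_zero, zero_add, fromBlocks_add]
  simp

lemma exists_isometry_of_ofProj_eq_zero {R : Type*} [Ring R] [StarRing R] [Algebra ℂ R]
    [StarModule ℂ R] {S : NonUnitalStarSubalgebra ℂ R} {p : S} (hp : IsStarProjection p)
    (h : K0.ofProj hp = 0) : ∃ (k : ℕ) (Z : Matrix (Fin k) (Fin 1 ⊕ Fin k) R),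
      Zᴴ * Z = fromBlocks (of fun _ _ => (p : R)) 0 0 1 ∧
      ∀ i j, ∃ c : ℂ, ∃ T ∈ S, Z i j = algebraMap ℂ R c + T := by
  obtain ⟨q, hq⟩ := (K0.ofProj_eq_zero_iff hp).1 h
  obtain ⟨Z, hZ⟩ : ∃ Z : Matrix (Fin q.size) (Fin 1 ⊕ Fin q.size) (Unitization ℂ S),
      Zᴴ * Z = fromBlocks (of fun _ _ => (p : Unitization ℂ S)) 0 0 1 :=
    exists_isometry_of_mvN (projMat hp).isProj q.isProj hq
  let ρ : Unitization ℂ S →⋆ₐ[ℂ] R := Unitization.starLift (NonUnitalStarSubalgebraClass.subtype S)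
  have hρ (x : Unitization ℂ S) : ρ x = algebraMap ℂ R x.fst + (x.snd : R) := rfl
  have hρp : (of fun _ _ => (p : Unitization ℂ S) : Matrix (Fin 1) (Fin 1) _).map ρ =
      of fun _ _ => (p : R) := Matrix.ext fun i j => by
    rw [map_apply, of_apply, hρ]
    simp
  refine ⟨q.size, Z.map ρ, ?_, fun i j => ⟨(Z i j).fst, (Z i j).snd, (Z i j).snd.2, hρ _⟩⟩
  calc (Z.map ρ)ᴴ * Z.map ρ = (Zᴴ * Z).map ρ := by
        rw [← conjTranspose_map _ (map_star ρ), ← Matrix.map_mul]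
    _ = fromBlocks (of fun _ _ => (p : R)) 0 0 1 := by
        rw [hZ, fromBlocks_map, hρp]
        simp

end Isometry

section Dimension

open Matrix

variable {E : Type*} [NormedAddCommGroup E] [NormedSpace ℂ E]

section MatAct

variable {l m n : Type*} [Fintype n]

/-- The action of a matrix of operators on a tuple of vectors. -/
def matAct (B : Matrix m n (E →L[ℂ] E)) : (n → E) →ₗ[ℂ] (m → E) :=
  LinearMap.pi fun i => ∑ j, (B i j).toLinearMap ∘ₗ LinearMap.proj j

lemma matAct_apply (B : Matrix m n (E →L[ℂ] E)) (u : n → E) (i : m) :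
    matAct B u i = ∑ j, B i j (u j) := by
  simp [matAct]

variable [Fintype m]

lemma matAct_mul (A : Matrix l m (E →L[ℂ] E)) (B : Matrix m n (E →L[ℂ] E)) (u : n → E) :
    matAct (A * B) u = matAct A (matAct B u) := by
  ext i
  simp only [matAct_apply, Matrix.mul_apply, map_sum, _root_.sum_apply, mul_apply_eq_comp]
  exact Finset.sum_comm

lemma norm_matAct_le (B : Matrix m n (E →L[ℂ] E)) (u : n → E) :
    ‖matAct B u‖ ≤ (∑ i, ∑ j, ‖B i j‖) * ‖u‖ := by
  refine (pi_norm_le_iff_of_nonneg (by positivity)).2 fun i => ?_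
  rw [matAct_apply]
  calc ‖∑ j, B i j (u j)‖ ≤ ∑ j, ‖B i j (u j)‖ := norm_sum_le _ _
    _ ≤ ∑ j, ‖B i j‖ * ‖u‖ := by
        gcongr with j
        exact ((B i j).le_opNorm _).trans (by gcongr; exact norm_le_pi_norm u j)
    _ = (∑ j, ‖B i j‖) * ‖u‖ := (Finset.sum_mul _ _ _).symm
    _ ≤ (∑ i, ∑ j, ‖B i j‖) * ‖u‖ := by
        gcongr
        exact Finset.single_le_sum (f := fun i => ∑ j, ‖B i j‖)
          (fun i _ => by positivity) (Finset.mem_univ i)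

lemma matAct_one [DecidableEq n] (u : n → E) : matAct (1 : Matrix n n (E →L[ℂ] E)) u = u := by
  ext i
  rw [matAct_apply, Finset.sum_eq_single i]
  · rw [one_apply_eq, one_apply_eq_self]
  · exact fun j _ hj => by rw [one_apply_ne hj.symm, _root_.zero_apply]
  · exact fun hi => absurd (Finset.mem_univ i) hi

lemma matAct_fromBlocks_one [DecidableEq n] (p : Matrix m m (E →L[ℂ] E)) (u : m ⊕ n → E)
    (hu : matAct p (u ∘ Sum.inl) = u ∘ Sum.inl) : matAct (fromBlocks p 0 0 1) u = u := by
  ext (i | i)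
  · simpa [matAct_apply] using congrFun hu i
  · simpa [matAct_apply] using congrFun (matAct_one (u ∘ Sum.inr)) i

/-- If `F` fixes `u` and annihilates `Z u`, then `Z u` is the value at `u` of the matrix of
commutators of `F` with the entries of `Z`. -/
lemma norm_matAct_le_of_norm_commutator_le {Z : Matrix m n (E →L[ℂ] E)} {F : E →L[ℂ] E} {ε : ℝ}
    (hε : ∀ i j, ‖F * Z i j - Z i j * F‖ ≤ ε) {u : n → E} (hu : ∀ j, F (u j) = u j)
    (hZu : ∀ i, F (matAct Z u i) = 0) :
    ‖matAct Z u‖ ≤ (Fintype.card m * Fintype.card n * ε) * ‖u‖ := by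
  have hcomm : matAct Z u = matAct (of fun i j => Z i j * F - F * Z i j) u := by
    ext i
    have hi := hZu i
    rw [matAct_apply, map_sum] at hi
    simp only [matAct_apply, of_apply, _root_.sub_apply, mul_apply_eq_comp, Finset.sum_sub_distrib,
      hi, sub_zero, hu]
  calc ‖matAct Z u‖ ≤ (∑ i, ∑ j, ‖Z i j * F - F * Z i j‖) * ‖u‖ := by
        rw [hcomm]
        exact norm_matAct_le _ _
    _ ≤ (∑ _i : m, ∑ _j : n, ε) * ‖u‖ := by
        gcongr with i _ j
        rw [norm_sub_rev]
        exact hε i j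
    _ = (Fintype.card m * Fintype.card n * ε) * ‖u‖ := by
        simp [mul_assoc]

end MatAct

/-- A linear map from `ℂ x ⊕ Uᵏ` to `Uᵏ` has a kernel. -/
lemma exists_ne_zero_forall_apply_eq_zero {k : ℕ} {U : Submodule ℂ E} [FiniteDimensional ℂ U]
    {x : E} (hx : x ≠ 0) (G : (Fin 1 ⊕ Fin k → E) →ₗ[ℂ] (Fin k → U)) :
    ∃ u : Fin 1 ⊕ Fin k → E, u ≠ 0 ∧ u (Sum.inl 0) ∈ Submodule.span ℂ {x} ∧
      (∀ j, u (Sum.inr j) ∈ U) ∧ G u = 0 := by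
  let ι : (ℂ × (Fin k → U)) →ₗ[ℂ] (Fin 1 ⊕ Fin k → E) :=
    LinearMap.pi (Sum.elim (fun _ => LinearMap.toSpanSingleton ℂ E x ∘ₗ LinearMap.fst ℂ ℂ _)
      fun j => U.subtype ∘ₗ LinearMap.proj j ∘ₗ LinearMap.snd ℂ ℂ _)
  have hker : (G ∘ₗ ι).ker ≠ ⊥ := LinearMap.ker_ne_bot_of_finrank_lt (by
    rw [Module.finrank_prod, Module.finrank_self]
    omega)
  obtain ⟨w, hw, hw0⟩ := Submodule.exists_mem_ne_zero_of_ne_bot hker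
  refine ⟨ι w, fun h => hw0 (Prod.ext ?_ (funext fun j => ?_)),
    Submodule.smul_mem _ _ (Submodule.mem_span_singleton_self x), fun j => (w.2 j).2, hw⟩
  · exact (smul_eq_zero.1 (congrFun h (Sum.inl 0) : w.1 • x = 0)).resolve_right hx
  · exact Subtype.ext (congrFun h (Sum.inr j))

/-- If the commutators were small, `Z` would map `ℂ x ⊕ (ran F)ᵏ` almost isometrically into
`(ran F)ᵏ`. -/
lemma exists_commutator_gap {k : ℕ} {Z : Matrix (Fin k) (Fin 1 ⊕ Fin k) (E →L[ℂ] E)}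
    {Z' : Matrix (Fin 1 ⊕ Fin k) (Fin k) (E →L[ℂ] E)} {p : E →L[ℂ] E}
    (hZ : Z' * Z = fromBlocks (of fun _ _ => p) 0 0 1) :
    ∃ ε : ℝ, 0 < ε ∧ ∀ (F : E →L[ℂ] E) (x : E), FiniteDimensional ℂ F.range → F * F = F →
      F x = x → p x = x → (∀ i j, ‖F * Z i j - Z i j * F‖ ≤ ε) → x = 0 := by
  set N : ℝ := ∑ i, ∑ j, ‖Z' i j‖
  set c : ℝ := Fintype.card (Fin k) * Fintype.card (Fin 1 ⊕ Fin k)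
  refine ⟨1 / (N * c + 1), by positivity, fun F x hF hFF hFx hpx hcomm => ?_⟩
  by_contra hx
  obtain ⟨u, hu, hux, huU, hFu⟩ := exists_ne_zero_forall_apply_eq_zero hx
    (LinearMap.pi fun i => F.toLinearMap.rangeRestrict ∘ₗ LinearMap.proj i ∘ₗ matAct Z)
  obtain ⟨a, ha⟩ := Submodule.mem_span_singleton.1 hux
  have hfix (j : Fin 1 ⊕ Fin k) : F (u j) = u j := by
    obtain j | j := j
    · rw [Subsingleton.elim j 0, ← ha, map_smul, hFx]
    · obtain ⟨y, hy⟩ := huU j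
      rw [← hy]
      exact DFunLike.congr_fun hFF y
  have hinv : matAct Z' (matAct Z u) = u := by
    rw [← matAct_mul, hZ]
    refine matAct_fromBlocks_one _ u (funext fun i => ?_)
    rw [matAct_apply, Fintype.sum_unique, Subsingleton.elim i 0]
    change p (u (Sum.inl 0)) = u (Sum.inl 0)
    rw [← ha, map_smul, hpx]
  have hle : ‖u‖ ≤ N * (c * (1 / (N * c + 1)) * ‖u‖) :=
    calc ‖u‖ = ‖matAct Z' (matAct Z u)‖ := by rw [hinv]
      _ ≤ N * ‖matAct Z u‖ := norm_matAct_le _ _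
      _ ≤ N * (c * (1 / (N * c + 1)) * ‖u‖) := by
          gcongr
          exact norm_matAct_le_of_norm_commutator_le hcomm hfix fun i =>
            congrArg Subtype.val (congrFun hFu i)
  have hlt : N * c * (1 / (N * c + 1)) < 1 := by
    rw [mul_one_div, div_lt_one (by positivity)]
    exact lt_add_one _
  have hpos : 0 < ‖u‖ := norm_pos_iff.2 hu
  nlinarith

end Dimension

/-! ### Almost commuting projections -/

section AlmostCommuting

lemma norm_commutator_le_of_norm_sub_le {R : Type*} [SeminormedRing R] {F S T : R} {δ ε : ℝ}
    (hF : ‖F‖ ≤ 1) (hS : ‖F * S - S * F‖ ≤ ε) (hTS : ‖T - S‖ ≤ δ) :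
    ‖F * T - T * F‖ ≤ ε + 2 * δ := by
  have hleft : ‖F * (T - S)‖ ≤ δ :=
    (norm_mul_le _ _).trans ((mul_le_of_le_one_left (norm_nonneg _) hF).trans hTS)
  have hright : ‖(T - S) * F‖ ≤ δ :=
    (norm_mul_le _ _).trans ((mul_le_of_le_one_right (norm_nonneg _) hF).trans hTS)
  calc ‖F * T - T * F‖ = ‖(F * S - S * F) + (F * (T - S) - (T - S) * F)‖ := by
        rw [mul_sub, sub_mul]
        abel_nf
    _ ≤ ‖F * S - S * F‖ + (‖F * (T - S)‖ + ‖(T - S) * F‖) :=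
        (norm_add_le _ _).trans (add_le_add_right (norm_sub_le _ _) _)
    _ ≤ ε + 2 * δ := by linarith

variable {E : Type*} [NormedAddCommGroup E] [InnerProductSpace ℂ E]

lemma norm_sub_starProjection_le (U : Submodule ℂ E) [U.HasOrthogonalProjection] (v : E) {u : E}
    (hu : u ∈ U) : ‖v - U.starProjection v‖ ≤ ‖v - u‖ := by
  rw [Submodule.starProjection_minimal]
  exact ciInf_le ⟨0, by rintro _ ⟨w, rfl⟩; exact norm_nonneg _⟩ (⟨u, hu⟩ : U)

lemma exists_finiteDimensional_approx {K : E →L[ℂ] E} (hK : IsCompactOperator K) {ε : ℝ}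
    (hε : 0 < ε) : ∃ U : Submodule ℂ E, FiniteDimensional ℂ U ∧ U ≤ K.range ∧
      ∀ (W : Submodule ℂ E) [W.HasOrthogonalProjection], U ≤ W →
        ‖W.starProjection * K - K‖ ≤ ε := by
  have hcompact := hK.isCompact_closure_image_ball (𝕜₁ := ℂ) (f := K.toLinearMap) 2
  obtain ⟨t, ht, hfin, hcover⟩ :=
    Metric.finite_approx_of_totallyBounded (hcompact.totallyBounded.subset subset_closure) ε hε
  refine ⟨Submodule.span ℂ t, FiniteDimensional.span_of_finite ℂ hfin,
    Submodule.span_le.2 fun y hy => ?_, fun W _ hW => ?_⟩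
  · obtain ⟨u, -, hu⟩ := ht hy
    exact ⟨u, hu⟩
  · refine ContinuousLinearMap.opNorm_le_of_unit_norm hε.le fun v hv => ?_
    have hball : K v ∈ K.toLinearMap '' Metric.ball 0 2 :=
      ⟨v, by rw [mem_ball_zero_iff, hv]; norm_num, rfl⟩
    obtain ⟨y, hy, hvy⟩ := Set.mem_iUnion₂.1 (hcover hball)
    rw [Metric.mem_ball, dist_eq_norm] at hvy
    change ‖W.starProjection (K v) - K v‖ ≤ ε
    rw [norm_sub_rev]
    exact (norm_sub_starProjection_le W (K v) (hW (Submodule.subset_span hy))).trans hvy.le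

variable [CompleteSpace E]

lemma norm_starProjection_commutator_le {W : Submodule ℂ E} [W.HasOrthogonalProjection]
    {X T : E →L[ℂ] E} (hX : IsSelfAdjoint X) (hWX : ∀ w ∈ W, X w = w) (hXT : Commute X T) {ε : ℝ}
    (hK : ‖W.starProjection * (X * T) - X * T‖ ≤ ε)
    (hK' : ‖W.starProjection * star (X * T) - star (X * T)‖ ≤ ε) :
    ‖W.starProjection * T - T * W.starProjection‖ ≤ 2 * ε := by
  set F := W.starProjection
  have hF : star F = F := isSelfAdjoint_starProjection W
  have hXF : X * F = F := by
    ext1 v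
    exact hWX _ (Submodule.starProjection_apply_mem W v)
  have hFX : F * X = F := by simpa only [star_mul, hF, hX.star_eq] using congrArg star hXF
  have hFT : F * T = F * (X * T) := by rw [← mul_assoc, hFX]
  have hTF : T * F = X * T * F := by rw [hXT.eq, mul_assoc, hXF]
  have hright : ‖X * T * F - X * T‖ ≤ ε := by
    rwa [← norm_star, star_sub, star_mul, hF]
  calc ‖F * T - T * F‖ = ‖(F * (X * T) - X * T) - (X * T * F - X * T)‖ := by
        rw [hFT, hTF, sub_sub_sub_cancel_right]
    _ ≤ ε + ε := (norm_sub_le _ _).trans (add_le_add hK hright)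
    _ = 2 * ε := (two_mul ε).symm

/-- `W` is spanned by finite-dimensional approximations of the ranges of `X Sᵢ` and `(X Sᵢ)*`. -/
lemma exists_finiteDimensional_norm_commutator_le {ι : Type*} [Finite ι] {X : E →L[ℂ] E}
    (hX : IsStarProjection X) {S : ι → E →L[ℂ] E} (hXS : ∀ i, Commute X (S i))
    (hK : ∀ i, IsCompactOperator (X * S i)) {x : E} (hx : X x = x) {ε : ℝ} (hε : 0 < ε) :
    ∃ (W : Submodule ℂ E) (_ : FiniteDimensional ℂ W), x ∈ W ∧
      ∀ i, ‖W.starProjection * S i - S i * W.starProjection‖ ≤ ε := by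
  choose U hUfin hUrange hU using fun i => exists_finiteDimensional_approx (hK i) (half_pos hε)
  choose U' hUfin' hUrange' hU' using fun i =>
    exists_finiteDimensional_approx (isCompactOperator_adjoint (hK i)) (half_pos hε)
  let W : Submodule ℂ E := (⨆ i, U i) ⊔ (⨆ i, U' i) ⊔ Submodule.span ℂ {x}
  have hXX : X * X = X := hX.isIdempotentElem
  have hXadj (i : ι) : star (X * S i) = X * star (S i) := by
    rw [(hXS i).eq, star_mul, hX.isSelfAdjoint.star_eq]
  have hWX : W ≤ LinearMap.eqLocus X.toLinearMap LinearMap.id := by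
    refine sup_le (sup_le (iSup_le fun i => (hUrange i).trans ?_)
      (iSup_le fun i => (hUrange' i).trans ?_)) ((Submodule.span_singleton_le_iff_mem _ _).2 hx)
    · rintro _ ⟨v, rfl⟩
      exact congrArg (fun T : E →L[ℂ] E => T (S i v)) hXX
    · rintro _ ⟨v, rfl⟩
      rw [hXadj]
      exact congrArg (fun T : E →L[ℂ] E => T (star (S i) v)) hXX
  refine ⟨W, inferInstance, Submodule.mem_sup_right (Submodule.mem_span_singleton_self _),
    fun i => ?_⟩
  rw [← mul_div_cancel₀ ε two_ne_zero]
  exact norm_starProjection_commutator_le hX.isSelfAdjoint (fun w hw => hWX hw) (hXS i)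
    (hU i W (le_sup_of_le_left (le_sup_of_le_left (le_iSup U i))))
    (hU' i W (le_sup_of_le_left (le_sup_of_le_right (le_iSup U' i))))

end AlmostCommuting

section RoeAlmostCommuting

variable {D : Type*} [MetricSpace D] [DiscreteTopology D]
  {H : Type*} [NormedAddCommGroup H] [InnerProductSpace ℂ H] [CompleteSpace H]

variable (H) in
/-- The projection of `ℓ²(D) ⊗ H` onto the vectors supported in the finite set `C`, as
multiplication by the indicator function of `C`. -/
def charOp (C : Finset D) : L2 D H →L[ℂ] L2 D H :=
  mulRep D H (restrictFinset 1 C)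

lemma charOp_single_of_mem [DecidableEq D] {C : Finset D} {x : D} (hx : x ∈ C) (h : H) :
    charOp H C (lp.single 2 x h) = lp.single 2 x h := by
  have hone : restrictFinset (1 : D → ℂ) C x = 1 := Set.indicator_of_mem (Finset.mem_coe.2 hx) _
  rw [charOp, mulRep_single, hone, one_smul]

lemma charOp_single_of_notMem [DecidableEq D] {C : Finset D} {x : D} (hx : x ∉ C) (h : H) :
    charOp H C (lp.single 2 x h) = 0 := by
  have hzero : restrictFinset (1 : D → ℂ) C x = 0 :=
    Set.indicator_of_notMem (Finset.mem_coe.not.2 hx) _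
  rw [charOp, mulRep_single, hzero, zero_smul]

lemma charOp_apply (C : Finset D) (v : L2 D H) (x : D) :
    charOp H C v x = (C : Set D).indicator v x := by
  by_cases hx : x ∈ (C : Set D) <;> simp [charOp, restrictFinset, hx]

lemma isStarProjection_charOp (C : Finset D) : IsStarProjection (charOp H C) := by
  refine IsStarProjection.map (x := restrictFinset 1 C) ⟨?_, ?_⟩ (mulRep D H)
  all_goals
    ext x
    by_cases hx : x ∈ (C : Set D) <;> simp [restrictFinset, hx]

lemma tsupport_restrictFinset_subset (f : D → ℂ) (C : Finset D) :
    tsupport (restrictFinset f C) ⊆ C := by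
  rw [tsupport, (isClosed_discrete _).closure_eq]
  exact Set.support_indicator_subset

lemma HasFinitePropagation.exists_apply_single_eq_zero [DecidableEq D] {T : L2 D H →L[ℂ] L2 D H}
    (hT : HasFinitePropagation (mulRep D H) T) :
    ∃ R, ∀ x y h, R < dist x y → T (lp.single 2 y h) x = 0 := by
  obtain ⟨R, hR, hT⟩ := hT
  refine ⟨R, fun x y h hxy => ?_⟩
  have hzero : charOp H {x} * T * charOp H {y} = 0 :=
    hT _ _ (ofReal_lt_setDist hxy (hR.trans hxy) fun a ha b hb => by
      have hax := tsupport_restrictFinset_subset _ _ ha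
      have hby := tsupport_restrictFinset_subset _ _ hb
      rw [Finset.coe_singleton, Set.mem_singleton_iff] at hax hby
      rw [hax, hby])
  have happly := congrArg (fun S : L2 D H →L[ℂ] L2 D H => S (lp.single 2 y h) x) hzero
  simpa [charOp_single_of_mem, charOp_apply] using happly

lemma IsIsolated.commute_charOp [DecidableEq D] {R : ℝ} {C : Finset D} (hC : IsIsolated R C)
    {T : L2 D H →L[ℂ] L2 D H} (hT : ∀ x y h, R < dist x y → T (lp.single 2 y h) x = 0) :
    Commute (charOp H C) T := by
  refine lp.ext_continuousLinearMap ENNReal.ofNat_ne_top fun y => ?_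
  ext h x
  change charOp H C (T (lp.single 2 y h)) x = T (charOp H C (lp.single 2 y h)) x
  rw [charOp_apply]
  by_cases hx : x ∈ C <;> by_cases hy : y ∈ C
  · rw [charOp_single_of_mem hy, Set.indicator_of_mem (Finset.mem_coe.2 hx)]
  · rw [charOp_single_of_notMem hy, map_zero, Set.indicator_of_mem (Finset.mem_coe.2 hx),
      hT x y h (hC x hx y hy)]
    rfl
  · rw [charOp_single_of_mem hy, Set.indicator_of_notMem (Finset.mem_coe.not.2 hx),
      hT x y h (dist_comm x y ▸ hC y hy x hx)]
  · rw [charOp_single_of_notMem hy, map_zero, Set.indicator_of_notMem (Finset.mem_coe.not.2 hx)]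
    rfl

lemma HasIsolatedFinsets.exists_norm_commutator_le [DecidableEq D] (hD : HasIsolatedFinsets D)
    {ι : Type*} [Finite ι] {T : ι → L2 D H →L[ℂ] L2 D H} (hT : ∀ i, T i ∈ RoeAlg D H) (h : H)
    {ε : ℝ} (hε : 0 < ε) :
    ∃ (x : D) (W : Submodule ℂ (L2 D H)) (_ : FiniteDimensional ℂ W), lp.single 2 x h ∈ W ∧
      ∀ i, ‖W.starProjection * T i - T i * W.starProjection‖ ≤ ε := by
  have happrox (i : ι) : ∃ S, (IsLocallyCompactOp (mulRep D H) S ∧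
      HasFinitePropagation (mulRep D H) S) ∧ ‖T i - S‖ ≤ ε / 4 := by
    obtain ⟨S, hS, hd⟩ := Metric.mem_closure_iff.1 (hT i) (ε / 4) (by positivity)
    exact ⟨S, hS, by rw [← dist_eq_norm]; exact hd.le⟩
  choose S hS hTS using happrox
  choose R hprop using fun i => (hS i).2.exists_apply_single_eq_zero
  obtain ⟨r, hr⟩ := Finite.bddAbove_range R
  obtain ⟨C, ⟨x, hx⟩, hC⟩ := hD ⟨max r 1, Set.mem_Ioi.2 (lt_max_of_lt_right one_pos)⟩
  have hcomm (i : ι) : Commute (charOp H C) (S i) :=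
    (hC.mono (le_max_of_le_left (hr ⟨i, rfl⟩))).commute_charOp (hprop i)
  obtain ⟨W, hW, hxW, hWS⟩ := exists_finiteDimensional_norm_commutator_le
    (isStarProjection_charOp C) hcomm (fun i => ((hS i).1 _).2) (charOp_single_of_mem hx h)
    (half_pos hε)
  refine ⟨x, W, hW, hxW, fun i => ?_⟩
  refine (norm_commutator_le_of_norm_sub_le (Submodule.starProjection_norm_le W) (hWS i)
    (hTS i)).trans_eq ?_
  ring

lemma iD_one_apply_single [DecidableEq D] (V : ℂ →ₗᵢ[ℂ] H) (x : D) :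
    (iD D V (uniformRoeOne D) : L2 D H →L[ℂ] L2 D H) (lp.single 2 x (V 1)) =
      lp.single 2 x (V 1) := by
  rw [← isoD_single]
  exact congrArg (isoD D V) (adjoint_apply_iso (isoD D V) _)

lemma HasIsolatedFinsets.iD_unitClass_ne_zero (hD : HasIsolatedFinsets D) (V : ℂ →ₗᵢ[ℂ] H) :
    K0.map (iD D V) (unitClass D) ≠ 0 := by
  classical
  intro hzero
  obtain ⟨k, Z, hZ, hentries⟩ := exists_isometry_of_ofProj_eq_zero (isStarProjection_iD_one D V)
    ((iD_unitClass V).symm.trans hzero)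
  choose c T hT hcT using hentries
  obtain ⟨ε, hε, hgap⟩ := exists_commutator_gap hZ
  obtain ⟨x, W, hW, hxW, hWT⟩ := hD.exists_norm_commutator_le
    (T := fun i : Fin k × (Fin 1 ⊕ Fin k) => T i.1 i.2) (fun i => hT i.1 i.2) (V 1) hε
  have hrank : FiniteDimensional ℂ W.starProjection.range := by
    rwa [Submodule.range_starProjection]
  have hx : (lp.single 2 x (V 1) : L2 D H) = 0 :=
    hgap W.starProjection _ hrank (Submodule.isIdempotentElem_starProjection W)
      (Submodule.starProjection_eq_self_iff.2 hxW) (iD_one_apply_single V x) fun i j => by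
        rw [hcT, mul_add, add_mul, ← Algebra.commutes, add_sub_add_left_eq_sub]
        exact hWT (i, j)
  have hnorm : ‖(lp.single 2 x (V 1) : L2 D H)‖ = 1 := by
    rw [lp.norm_single (by norm_num), V.norm_map, norm_one]
  rw [hx, norm_zero] at hnorm
  exact zero_ne_one hnorm

end RoeAlmostCommuting

end CoarseK

end

theorem corollary3p6_general (D : Type*) [MetricSpace D] [DiscreteTopology D]
    [CoarseK.HasBoundedGeometry D]
    (H : Type*) [NormedAddCommGroup H] [InnerProductSpace ℂ H] [CompleteSpace H]
    (hH : ¬ FiniteDimensional ℂ H) (V : ℂ →ₗᵢ[ℂ] H) (α : Set.Ioi (0 : ℝ)) :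
    CoarseK.K0.map (CoarseK.iD D V) (CoarseK.unitClass D) = 0 ↔
      CoarseK.toBMLimit D α (CoarseK.bmOnes (CoarseK.ripsGraph D α)) = 0 :=
  (CoarseK.pointsEscape_or_hasIsolatedFinsets D).elim
    (fun hD => iff_of_true (hD.iD_unitClass_eq_zero hH V) (hD.toBMLimit_bmOnes_eq_zero α))
    (fun hD => iff_of_false (hD.iD_unitClass_ne_zero V) (hD.toBMLimit_bmOnes_ne_zero α))

theorem corollary3p6 (D : Type*) [MetricSpace D] [CoarseK.IsUniformlyDiscrete D]
    [CoarseK.HasBoundedGeometry D]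
    (H : Type*) [NormedAddCommGroup H] [InnerProductSpace ℂ H] [CompleteSpace H]
    (hH : ¬ FiniteDimensional ℂ H) (V : ℂ →ₗᵢ[ℂ] H) (α : Set.Ioi (0 : ℝ)) :
    CoarseK.K0.map (CoarseK.iD D V) (CoarseK.unitClass D) = 0 ↔
      CoarseK.toBMLimit D α (CoarseK.bmOnes (CoarseK.ripsGraph D α)) = 0 :=
  corollary3p6_general D H hH V α
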